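/- All graphs are finite, simple and undirected. For a graph $G$ with adjacency matrix $A(G)$ and diagonal degree matrix $D(G)$ and for $0\le\alpha<1$, let $\rho_\alpha(G)$ be the spectral radius of $A_\alpha(G)=\alpha D(G)+(1-\alpha)A(G)$. A connected graph with $n$ vertices and $n+t-1$ edges is called $t$-cyclic (unicyclic for $t=1$, bicyclic for $t=2$). For $t\ge 1$ the base $\widehat G$ of a $t$-cyclic graph $G$ is its unique minimal $t$-cyclic subgraph. An internal path of $G$ is a path $v_1v_2\dots v_k$ with $k\ge2$ (or a cycle, $v_1=v_k$) such that $d(v_1)\ge 3$, $d(v_k)\ge 3$ and $d(v_2)=\dots=d(v_{k-1})=2$. A diametral path of $G$ is a path whose length equals both the diameter of $G$ and the distance between its ends. Let $G$ be a graph with maximal $\alpha$-spectral radius among all $t$-cyclic graphs of order $n$ and diameter $d$. Then: (1) Every edge of every internal path of $G$ lies in a triangle of $G$. If moreover $t\ge 1$, then: (2) Every path $P$ of length $d$ in $G$ (in particular every diametral path) satisfies $V(P)\cap V(\widehat G)\ne\varnothing$. (3) Let $P$ be a diametral path of $G$ with $V(P)\not\subseteq V(\widehat G)$, and let $U'=V(G)\setminus(V(P)\cup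 V(\widehat G))$. Then there is a vertex $w\in V(\widehat G)$ such that the induced subgraph $G[U'\cup\{w\}]$ is a star with center $w$ (a single vertex counting as a star). (4) If $t=1$, then $\widehat G\cong C_3$. If $t=2$, then $\widehat G$ is isomorphic to the bowtie $\infty$ (two triangles with exactly one common vertex) or to $\Theta=K_4-e$ ($K_4$ with one edge removed). -/

import Mathlib

noncomputable section

namespace AlphaExtremal

open Classical in
/-- The matrix `A_α(G) = α D(G) + (1 - α) A(G)`. -/
def alphaMatrix {V : Type*} [Fintype V] (α : ℝ) (G : SimpleGraph V) : Matrix V V ℝ :=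
  α • G.degMatrix ℝ + (1 - α) • G.adjMatrix ℝ

open Classical in
/-- The `α`-spectral radius `ρ_α(G)`. The matrix is real symmetric, so all its complex eigenvalues
are real and the spectral radius over `ℝ` is the spectral radius. -/
def alphaSpectralRadius {V : Type*} [Fintype V] (α : ℝ) (G : SimpleGraph V) : ENNReal :=
  spectralRadius ℝ (alphaMatrix α G)

/-- A (finite) graph is `t`-cyclic if it is connected and `m = n + t - 1`, where `m` is the number
of edges and `n` the number of vertices. -/
def IsTCyclic {V : Type*} (t : ℕ) (G : SimpleGraph V) : Prop :=
  G.Connected ∧ G.edgeSet.ncard + 1 = Nat.card V + t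

/-- The class of `t`-cyclic graphs of order `n` and diameter `d`. -/
def cyclicGraphs (t n d : ℕ) : Set (SimpleGraph (Fin n)) :=
  {G | IsTCyclic t G ∧ G.diam = d}

/-- `G` has maximal `α`-spectral radius among the `t`-cyclic graphs of order `n` and
diameter `d`. -/
def IsExtremal (α : ℝ) (t n d : ℕ) (G : SimpleGraph (Fin n)) : Prop :=
  G ∈ cyclicGraphs t n d ∧
    ∀ H ∈ cyclicGraphs t n d, alphaSpectralRadius α H ≤ alphaSpectralRadius α G

/-- `B` is a base of the `t`-cyclic graph `G`: a minimal `t`-cyclic subgraph of `G`. (For a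
`t`-cyclic graph with `t ≥ 1` there is exactly one.) -/
def IsBase {V : Type*} (t : ℕ) (G : SimpleGraph V) (B : G.Subgraph) : Prop :=
  Minimal (fun H : G.Subgraph => IsTCyclic t H.coe) B

/-- The end vertices of the walk `p` have degree at least three, all others have degree two. -/
def HasInternalDegrees {V : Type*} [Fintype V] (G : SimpleGraph V) {u v : V}
    (p : G.Walk u v) : Prop :=
  3 ≤ (G.neighborSet u).ncard ∧ 3 ≤ (G.neighborSet v).ncard ∧
    ∀ x ∈ p.support, x ≠ u → x ≠ v → (G.neighborSet x).ncard = 2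

/-- `e` is an edge of some internal path of `G`; an internal path is a path or a cycle
`v₁, …, v_k` (with `v₁ = v_k` for a cycle) such that `d(v₁), d(v_k) ≥ 3` and
`d(v₂) = ⋯ = d(v_{k-1}) = 2`. -/
def IsInternalPathEdge {V : Type*} [Fintype V] (G : SimpleGraph V) (e : Sym2 V) : Prop :=
  (∃ (u v : V) (p : G.Walk u v), p.IsPath ∧ HasInternalDegrees G p ∧ e ∈ p.edges) ∨
  (∃ (u : V) (p : G.Walk u u), p.IsCycle ∧ HasInternalDegrees G p ∧ e ∈ p.edges)

/-- `e` is an edge of some triangle `C₃` of `G`. -/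
def InTriangle {V : Type*} (G : SimpleGraph V) (e : Sym2 V) : Prop :=
  ∃ a b c : V, G.Adj a b ∧ G.Adj b c ∧ G.Adj c a ∧ e = s(a, b)

/-- A diametral path: a path whose length is the diameter and is the distance of its ends. -/
def IsDiametralPath {V : Type*} (G : SimpleGraph V) {u v : V} (p : G.Walk u v) : Prop :=
  p.IsPath ∧ p.length = G.diam ∧ G.dist u v = G.diam

/-- The vertices that lie neither on the walk `p` nor in the subgraph `B`. -/
def outsideVertices {V : Type*} (G : SimpleGraph V) {u v : V} (p : G.Walk u v)
    (B : G.Subgraph) : Set V :=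
  {x | x ∉ p.support ∧ x ∉ B.verts}

/-- The induced subgraph `G[U ∪ {w}]` is a star with center `w`. -/
def InducesStar {V : Type*} (G : SimpleGraph V) (U : Set V) (w : V) : Prop :=
  G.induce (insert w U) = SimpleGraph.starGraph ⟨w, Set.mem_insert w U⟩

/-- The bowtie `∞`: two triangles with one common vertex. -/
def bowtie : SimpleGraph (Fin 5) :=
  SimpleGraph.fromEdgeSet {s(0, 1), s(0, 2), s(1, 2), s(0, 3), s(0, 4), s(3, 4)}

/-- The graph `Θ`, that is `K₄` minus an edge. -/
def thetaGraph : SimpleGraph (Fin 4) :=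
  (⊤ : SimpleGraph (Fin 4)).deleteEdges {s(0, 2)}

/-- Every finite `t`-cyclic graph has a base. -/
theorem exists_isBase {V : Type*} [Finite V] {t : ℕ} {G : SimpleGraph V} (hG : IsTCyclic t G) :
    ∃ B : G.Subgraph, IsBase t G B := by
  have e : (⊤ : G.Subgraph).coe ≃g G := SimpleGraph.Subgraph.topIso
  have hT : IsTCyclic t (⊤ : G.Subgraph).coe := by
    refine ⟨e.connected_iff.2 hG.1, ?_⟩
    have h1 : (⊤ : G.Subgraph).coe.edgeSet.ncard = G.edgeSet.ncard := by
      rw [← Nat.card_coe_set_eq, ← Nat.card_coe_set_eq]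
      exact Nat.card_congr e.mapEdgeSet
    rw [h1, Nat.card_congr e.toEquiv]
    exact hG.2
  obtain ⟨B, -, hB⟩ := (Set.toFinite {H : G.Subgraph | IsTCyclic t H.coe}).exists_le_minimal hT
  exact ⟨B, hB⟩

end AlphaExtremal

end

/-!
The theorem describes graphs `G` that maximise the spectral radius of `A_α(G)` among the `t`-cyclic
graphs of order `n` and diameter `d`. Write `x` for the Perron vector of `G`.

**The diameter constraint can be relaxed.** If neither of two adjacent vertices dominates the other,
then moving the private neighbours of the one with the smaller Perron entry to the other increases
the spectral radius and lowers the diameter by at most one (`exists_lt_of_not_nested`). Such a pair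
exists whenever the diameter is at least three, so for `d ≥ 2` the graph `G` is maximal even among
the `t`-cyclic graphs of diameter *at least* `d` (`IsExtremal.radius_le`). From here on the diameter
only has to be bounded below, which is done by exhibiting a function that changes by at most one
along every edge (`le_diam_of_lipschitz`).

**Contraction.** Let `ab` be an edge in no triangle with `x a ≤ x b`. Contracting it lowers the
diameter by at most one, and hanging the freed vertex at the end of a longest geodesic of the
contracted graph restores the diameter (`exists_contract`). An explicit test vector shows that this
would increase the spectral radius if `a` had degree at least three, or degree two with a further
neighbour `c` satisfying `x c ≥ x a`. Hence `a` has at most one further neighbour `c`, and then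
`x c < x a` (`IsExtremal.lt_of_adj`). The edge `ca` is then again in no triangle, so one can descend
along a path of vertices of degree two with decreasing weights. On an internal path such a
descent would never stop, which proves the first claim (`IsExtremalWeight.inTriangle`).

**The base.** By counting edges, `G` is its base with trees hanging from it (`exists_isHanging`),
and the base has minimum degree two (`IsBase.exists_adj_ne`). The descent must end in a hanging
tree; therefore every edge of the base is in a triangle
(`IsExtremalWeight.exists_base_triangle`), weights
outside the base increase towards the base, and no vertex outside the base has two children. So a
path outside the base is monotone in the height above the base and is shorter than the diameter,
which is the second claim. For the third, a pendant vertex off a diametral path could be moved to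
any vertex with a Perron entry at least that of its neighbour; so its neighbour has the largest
entry, lies in the base, and is the same for all such pendant vertices
(`IsExtremalWeight.exists_outside_parent`). The fourth claim is a degree count for graphs with all
edges in triangles. For `d ≤ 1` the graph is complete and everything is immediate.
-/

namespace AlphaExtremal

open Finset

/-! ### The operator `A_α(G)` and its Perron vector -/

section Spectral

variable {V : Type*}

open Classical in
/-- The entry of the adjacency matrix of `G` at `(i, j)`, with classical decidability. -/
noncomputable def adjInd (G : SimpleGraph V) (i j : V) : ℝ := if G.Adj i j then 1 else 0

variable {G : SimpleGraph V} {i j : V} {α : ℝ}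

lemma adjInd_of_adj (h : G.Adj i j) : adjInd G i j = 1 := if_pos h

lemma adjInd_of_not_adj (h : ¬G.Adj i j) : adjInd G i j = 0 := if_neg h

lemma adjInd_nonneg : 0 ≤ adjInd G i j := by
  unfold adjInd; split_ifs <;> norm_num

variable [Fintype V]

/-- The map `x ↦ A_α(G) x`, written as a sum over pairs of vertices: the diagonal part is absorbed
in the summands because the degree of `i` is the `i`-th row sum of the adjacency matrix. -/
noncomputable def alphaOp (α : ℝ) (G : SimpleGraph V) (x : V → ℝ) (i : V) : ℝ :=
  ∑ j, adjInd G i j * (α * x i + (1 - α) * x j)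

open Classical in
lemma alphaMatrix_mulVec (α : ℝ) (G : SimpleGraph V) (x : V → ℝ) :
    (alphaMatrix α G).mulVec x = alphaOp α G x := by
  ext i
  have hdeg : (G.degree i : ℝ) = ∑ j, adjInd G i j := by
    simp [adjInd, ← SimpleGraph.card_neighborFinset_eq_degree,
      SimpleGraph.neighborFinset_eq_filter]
  have h1 : (G.degMatrix ℝ).mulVec x i = G.degree i * x i := by
    simp [SimpleGraph.degMatrix, Matrix.mulVec_diagonal]
  have h2 : (G.adjMatrix ℝ).mulVec x i = ∑ j, adjInd G i j * x j := by
    simp [Matrix.mulVec, dotProduct, adjInd, SimpleGraph.adjMatrix_apply]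
  rw [alphaMatrix, Matrix.add_mulVec, Matrix.smul_mulVec, Matrix.smul_mulVec, Pi.add_apply,
    Pi.smul_apply, Pi.smul_apply, h1, h2, hdeg]
  simp only [smul_eq_mul, alphaOp, mul_sum, sum_mul, ← sum_add_distrib]
  refine sum_congr rfl fun j _ => by ring

open Classical in
lemma alphaMatrix_isHermitian (α : ℝ) (G : SimpleGraph V) : (alphaMatrix α G).IsHermitian := by
  have h1 : (G.degMatrix ℝ).IsHermitian := by
    simp [SimpleGraph.degMatrix, Matrix.IsHermitian, Matrix.conjTranspose,
      Matrix.diagonal_transpose, Matrix.diagonal_map]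
  have h2 : (G.adjMatrix ℝ).IsHermitian := by
    ext i j
    simp [SimpleGraph.adjMatrix_apply, G.adj_comm]
  unfold alphaMatrix
  ext i j
  have := congrFun (congrFun h1 i) j
  have := congrFun (congrFun h2 i) j
  simp_all [Matrix.conjTranspose_apply]

/-- Rayleigh's principle: a vector whose Rayleigh quotient is at least `l`, and which is not an
eigenvector for `l`, forces the spectral radius to exceed `l`. -/
lemma ofReal_lt_alphaSpectralRadius {l : ℝ} (hl : 0 ≤ l) (z : V → ℝ)
    (h : ∑ i, z i * (l * z i) ≤ ∑ i, z i * alphaOp α G z i)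
    (hne : ∃ i, alphaOp α G z i ≠ l * z i) :
    ENNReal.ofReal l < alphaSpectralRadius α G := by
  classical
  by_contra! hcon
  have hH := alphaMatrix_isHermitian α G
  have hle : ∀ k ∈ spectrum ℝ (alphaMatrix α G), k ≤ l := by
    intro k hk
    have h1 : (‖k‖₊ : ENNReal) ≤ ENNReal.ofReal l := le_trans (le_iSup₂ (f := fun (k : ℝ)
      (_ : k ∈ spectrum ℝ (alphaMatrix α G)) => (‖k‖₊ : ENNReal)) k hk) hcon
    have h2 : ‖k‖ ≤ l := by
      rw [← ENNReal.ofReal_le_ofReal_iff hl, ofReal_norm]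
      exact h1
    exact (le_abs_self k).trans h2
  have hsp : (algebraMap ℝ (Matrix V V ℝ) l - alphaMatrix α G).PosSemidef := by
    rw [Matrix.posSemidef_iff_isHermitian_and_spectrum_nonneg]
    refine ⟨Matrix.IsHermitian.sub ?_ hH, ?_⟩
    · rw [Matrix.IsHermitian, Matrix.algebraMap_eq_diagonal]
      simp [Matrix.conjTranspose, Matrix.diagonal_transpose, Matrix.diagonal_map]
    · rw [← spectrum.singleton_sub_eq]
      rintro _ ⟨_, rfl, k, hk, rfl⟩
      exact sub_nonneg.2 (hle k hk)
  have hmv : (algebraMap ℝ (Matrix V V ℝ) l - alphaMatrix α G).mulVec z =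
      fun i => l * z i - alphaOp α G z i := by
    rw [Matrix.sub_mulVec, alphaMatrix_mulVec, Algebra.algebraMap_eq_smul_one, Matrix.smul_mulVec,
      Matrix.one_mulVec]
    rfl
  have h0 : star z ⬝ᵥ (algebraMap ℝ (Matrix V V ℝ) l - alphaMatrix α G).mulVec z = 0 := by
    refine le_antisymm ?_ (hsp.dotProduct_mulVec_nonneg z)
    rw [hmv]
    simp only [dotProduct, star_trivial, mul_sub, sum_sub_distrib]
    linarith
  rw [hsp.dotProduct_mulVec_zero_iff, hmv] at h0
  obtain ⟨i, hi⟩ := hne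
  have := congrFun h0 i
  simp only [Pi.zero_apply] at this
  exact hi (by linarith)

/-- A nonnegative vector `z` with `A_α(G) z ≥ l z` that is not an eigenvector for `l` forces the
spectral radius to exceed `l`. -/
lemma ofReal_lt_alphaSpectralRadius_of_le {l : ℝ} (hl : 0 ≤ l) (z : V → ℝ) (hz : ∀ i, 0 ≤ z i)
    (h : ∀ i, l * z i ≤ alphaOp α G z i) (hne : ∃ i, alphaOp α G z i ≠ l * z i) :
    ENNReal.ofReal l < alphaSpectralRadius α G :=
  ofReal_lt_alphaSpectralRadius hl z
    (sum_le_sum fun i _ => mul_le_mul_of_nonneg_left (h i) (hz i)) hne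

/-- Perron–Frobenius for `A_α(G)` on a connected graph: the absolute value of an eigenvector for an
eigenvalue of largest modulus is itself an eigenvector, and it has no zero entry. -/
lemma exists_perron [Nonempty V] (hα0 : 0 ≤ α) (hα1 : α < 1) (hG : G.Connected) :
    ∃ (l : ℝ) (x : V → ℝ), 0 ≤ l ∧ (∀ i, 0 < x i) ∧ (∀ i, alphaOp α G x i = l * x i) ∧
      alphaSpectralRadius α G = ENNReal.ofReal l := by
  classical
  have hH := alphaMatrix_isHermitian α G
  obtain ⟨k, -, hk⟩ := Finset.exists_max_image (Finset.univ : Finset V)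
    (fun k => |hH.eigenvalues k|) Finset.univ_nonempty
  set l := |hH.eigenvalues k| with hl
  have hl0 : 0 ≤ l := abs_nonneg _
  have hrad : alphaSpectralRadius α G = ENNReal.ofReal l := by
    unfold alphaSpectralRadius spectralRadius
    rw [hH.spectrum_real_eq_range_eigenvalues]
    refine le_antisymm ?_ ?_
    · refine iSup₂_le ?_
      rintro _ ⟨j, rfl⟩
      change (‖hH.eigenvalues j‖ₑ : ENNReal) ≤ _
      rw [← ofReal_norm]
      exact ENNReal.ofReal_le_ofReal (hk j (mem_univ _))
    · have : ENNReal.ofReal l = (‖hH.eigenvalues k‖₊ : ENNReal) := by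
        change _ = ‖hH.eigenvalues k‖ₑ
        rw [← ofReal_norm]; rfl
      rw [this]
      exact le_iSup₂ (f := fun (a : ℝ)
        (_ : a ∈ Set.range hH.eigenvalues) => (‖a‖₊ : ENNReal)) _ ⟨k, rfl⟩
  set u : V → ℝ := (hH.eigenvectorBasis k).ofLp with hu
  have hueq : ∀ i, alphaOp α G u i = hH.eigenvalues k * u i := by
    intro i
    have := congrFun (hH.mulVec_eigenvectorBasis k) i
    rwa [alphaMatrix_mulVec] at this
  have hu0 : u ≠ 0 := by
    intro h0
    have h1 := hH.eigenvectorBasis.orthonormal.ne_zero k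
    exact h1 (by ext i; exact congrFun h0 i)
  have hsub : ∀ i, l * |u i| ≤ alphaOp α G (fun j => |u j|) i := by
    intro i
    rw [hl, ← abs_mul, ← hueq]
    refine (abs_sum_le_sum_abs _ _).trans (sum_le_sum fun j _ => ?_)
    rw [abs_mul, abs_of_nonneg adjInd_nonneg]
    refine mul_le_mul_of_nonneg_left ((abs_add_le _ _).trans ?_) adjInd_nonneg
    rw [abs_mul, abs_mul, abs_of_nonneg hα0, abs_of_pos (sub_pos.2 hα1)]
  have heq : ∀ i, alphaOp α G (fun j => |u j|) i = l * |u i| := by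
    by_contra! hne
    have := ofReal_lt_alphaSpectralRadius_of_le hl0 (fun j => |u j|) (fun i => abs_nonneg _)
      hsub hne
    rw [hrad] at this
    exact lt_irrefl _ this
  refine ⟨l, fun j => |u j|, hl0, ?_, heq, hrad⟩
  -- a zero entry propagates to the neighbours, hence to the whole connected graph
  have hstep : ∀ i j, G.Adj i j → u i = 0 → u j = 0 := by
    intro i j hij hi
    have h1 := heq i
    simp only [alphaOp, hi, abs_zero, mul_zero, zero_add] at h1
    rw [sum_eq_zero_iff_of_nonneg (fun j _ => mul_nonneg adjInd_nonneg
      (mul_nonneg (sub_pos.2 hα1).le (abs_nonneg _)))] at h1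
    have h2 := h1 j (mem_univ _)
    rw [adjInd_of_adj hij, one_mul] at h2
    rcases mul_eq_zero.1 h2 with h3 | h3
    · linarith
    · exact abs_eq_zero.1 h3
  intro i
  refine abs_pos.2 fun hi => hu0 (funext fun j => ?_)
  obtain ⟨p⟩ := hG.preconnected i j
  induction p with
  | nil => exact hi
  | cons hadj _ ih => exact ih (hstep _ _ hadj hi)

end Spectral

/-! ### Moving edges from one vertex to another -/

section Move

variable {V : Type*}

open Classical in
/-- `G'` arises from `G` by replacing the edges `vw`, `w ∈ S`, by `uw`. This is expressed on the
adjacency matrices, so that the degenerate case `u = v`, `G' = G` is included. -/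
def IsMove (G G' : SimpleGraph V) (v u : V) (S : Finset V) : Prop :=
  ∀ i j, adjInd G' i j = adjInd G i j + (if i = u ∧ j ∈ S then 1 else 0) +
    (if j = u ∧ i ∈ S then 1 else 0) - (if i = v ∧ j ∈ S then 1 else 0) -
    (if j = v ∧ i ∈ S then 1 else 0)

/-- The graph obtained from `G` by replacing the edges `vw`, `w ∈ S`, by `uw`. -/
def moveEdges (G : SimpleGraph V) (v u : V) (S : Finset V) : SimpleGraph V where
  Adj x y := x ≠ y ∧ ((G.Adj x y ∧ ¬(x = v ∧ y ∈ S) ∧ ¬(y = v ∧ x ∈ S)) ∨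
    (x = u ∧ y ∈ S) ∨ (y = u ∧ x ∈ S))
  symm := ⟨fun x y h => by
    have := G.adj_comm x y
    exact ⟨h.1.symm, by tauto⟩⟩
  loopless := ⟨fun x h => h.1 rfl⟩

variable {G G' : SimpleGraph V} {u v : V} {S : Finset V}

lemma isMove_refl (G : SimpleGraph V) (u : V) (S : Finset V) : IsMove G G u u S := by
  intro i j; ring

lemma isMove_moveEdges (huv : v ≠ u) (hv : ∀ w ∈ S, G.Adj v w) (hu : ∀ w ∈ S, ¬G.Adj u w)
    (huS : u ∉ S) : IsMove G (moveEdges G v u S) v u S := by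
  classical
  have hvS : v ∉ S := fun h => (hv v h).ne rfl
  intro i j
  by_cases hiu : i = u
  · subst hiu
    have h1 : ∀ j, (moveEdges G v i S).Adj i j ↔ G.Adj i j ∨ j ∈ S := by
      intro j
      by_cases hj : j ∈ S
      · have : i ≠ j := fun h => huS (h ▸ hj)
        simp [moveEdges, hj, this]
      · simp only [moveEdges, hj, huS]
        simp only [and_false, not_false_eq_true, and_true, or_false, and_iff_right_iff_imp]
        exact fun h => h.ne
    by_cases hj : j ∈ S
    · have hji : j ≠ i := fun h => huS (h ▸ hj)
      rw [adjInd_of_adj ((h1 j).2 (Or.inr hj)), adjInd_of_not_adj (hu j hj)]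
      simp [hj, huv.symm, huS]
    · have h2 : adjInd (moveEdges G v i S) i j = adjInd G i j := by
        by_cases h : G.Adj i j
        · rw [adjInd_of_adj h, adjInd_of_adj ((h1 j).2 (Or.inl h))]
        · rw [adjInd_of_not_adj h, adjInd_of_not_adj (by rw [h1]; tauto)]
      rw [h2]; simp [hj, huS]
  by_cases hju : j = u
  · subst hju
    by_cases hi : i ∈ S
    · have hji : i ≠ v := fun h => hvS (h ▸ hi)
      rw [adjInd_of_adj ?_, adjInd_of_not_adj (fun h => hu i hi h.symm)]
      · simp [hi, huS, huv.symm]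
      · exact ⟨hiu, by tauto⟩
    · have h2 : adjInd (moveEdges G v j S) i j = adjInd G i j := by
        by_cases h : G.Adj i j
        · rw [adjInd_of_adj h, adjInd_of_adj
            (show (moveEdges G v j S).Adj i j from ⟨hiu, by tauto⟩)]
        · rw [adjInd_of_not_adj h, adjInd_of_not_adj (by simp [moveEdges]; tauto)]
      rw [h2]; simp [hi, huS]
  have h1 : (moveEdges G v u S).Adj i j ↔ G.Adj i j ∧ ¬(i = v ∧ j ∈ S) ∧ ¬(j = v ∧ i ∈ S) := by
    simp only [moveEdges, hiu, hju, false_and, or_false, and_iff_right_iff_imp]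
    exact fun h => h.1.ne
  by_cases hiv : i = v ∧ j ∈ S
  · obtain ⟨rfl, hj⟩ := hiv
    rw [adjInd_of_not_adj (by rw [h1]; tauto), adjInd_of_adj (hv j hj)]
    simp [hj, hiu, hju, hvS]
  by_cases hjv : j = v ∧ i ∈ S
  · obtain ⟨rfl, hi⟩ := hjv
    rw [adjInd_of_not_adj (by rw [h1]; tauto), adjInd_of_adj (hv i hi).symm]
    simp [hi, hiu, hju, hvS]
  have h2 : adjInd (moveEdges G v u S) i j = adjInd G i j := by
    by_cases h : G.Adj i j
    · rw [adjInd_of_adj h, adjInd_of_adj (h1.2 ⟨h, hiv, hjv⟩)]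
    · rw [adjInd_of_not_adj h, adjInd_of_not_adj (by rw [h1]; tauto)]
  rw [h2]; simp [hiu, hju, hiv, hjv]

lemma IsMove.adj_iff (h : IsMove G G' v u S) {i j : V} (hi : i ∉ S) (hj : j ∉ S) :
    G'.Adj i j ↔ G.Adj i j := by
  have h1 := h i j
  simp only [hi, hj, and_false, if_false, add_zero, sub_zero] at h1
  by_cases h2 : G.Adj i j <;> by_cases h3 : G'.Adj i j <;>
    simp_all [adjInd_of_adj, adjInd_of_not_adj]

variable [Fintype V]

lemma sum_adjInd (G : SimpleGraph V) : ∑ i, ∑ j, adjInd G i j = 2 * (G.edgeSet.ncard : ℝ) := by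
  classical
  have h := G.sum_degrees_eq_twice_card_edges
  have h1 : ∀ i, (G.degree i : ℝ) = ∑ j, adjInd G i j := by
    intro i
    unfold adjInd
    rw [Finset.sum_boole, ← SimpleGraph.card_neighborFinset_eq_degree,
      SimpleGraph.neighborFinset_eq_filter]
  have h2 : G.edgeSet.ncard = #G.edgeFinset := by
    rw [← SimpleGraph.coe_edgeFinset, Set.ncard_coe_finset]
  rw [h2, ← sum_congr rfl fun i _ => h1 i]
  exact_mod_cast h

lemma IsMove.ncard_edgeSet (h : IsMove G G' v u S) : G'.edgeSet.ncard = G.edgeSet.ncard := by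
  classical
  have h1 := sum_adjInd G'
  simp only [h _ _, sum_add_distrib, sum_sub_distrib, sum_adjInd G] at h1
  have h2 : ∀ w : V, (∑ i : V, ∑ j : V, if i = w ∧ j ∈ S then (1 : ℝ) else 0) = #S := by
    intro w
    simp [ite_and]
  have h3 : ∀ w : V, (∑ i : V, ∑ j : V, if j = w ∧ i ∈ S then (1 : ℝ) else 0) = #S := by
    intro w
    simp [ite_and]
  rw [h2, h2, h3, h3] at h1
  have : (G'.edgeSet.ncard : ℝ) = G.edgeSet.ncard := by linarith
  exact_mod_cast this

open Classical in
lemma IsMove.alphaOp_eq (h : IsMove G G' v u S) (α : ℝ) (z : V → ℝ) (i : V) :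
    alphaOp α G' z i = alphaOp α G z i +
      (if i = u then ∑ w ∈ S, (α * z u + (1 - α) * z w) else 0) -
      (if i = v then ∑ w ∈ S, (α * z v + (1 - α) * z w) else 0) +
      (if i ∈ S then (1 - α) * (z u - z v) else 0) := by
  unfold alphaOp
  generalize 1 - α = β
  simp only [h _ _, add_mul, sub_mul, sum_add_distrib, sum_sub_distrib, ite_mul, one_mul, zero_mul]
  have h2 : ∀ w : V, (∑ j : V, if i = w ∧ j ∈ S then α * z i + β * z j else 0) =
      if i = w then ∑ j ∈ S, (α * z w + β * z j) else 0 := by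
    intro w
    by_cases hi : i = w
    · subst hi; simp
    · simp [hi]
  have h3 : ∀ w : V, (∑ j : V, if j = w ∧ i ∈ S then α * z i + β * z j else 0) =
      if i ∈ S then α * z i + β * z w else 0 := by
    intro w
    by_cases hi : i ∈ S <;> simp [hi]
  rw [h2, h2, h3, h3]
  simp only [sum_add_distrib]
  split_ifs <;> ring

/-- Moving edges towards a vertex with a larger Perron entry increases the spectral radius. -/
lemma IsMove.ofReal_lt {α l : ℝ} {x : V → ℝ} (hα0 : 0 ≤ α) (hα1 : α < 1) (hl : 0 ≤ l)
    (hx : ∀ i, 0 < x i) (hxl : ∀ i, alphaOp α G x i = l * x i)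
    (h : IsMove G G' v u S) (huv : v ≠ u) (hvS : v ∉ S) (hS : S.Nonempty) (hvu : x v ≤ x u) :
    ENNReal.ofReal l < alphaSpectralRadius α G' := by
  classical
  have hβ : 0 < 1 - α := sub_pos.2 hα1
  have hterm : ∀ a w, 0 < α * x a + (1 - α) * x w := fun a w =>
    add_pos_of_nonneg_of_pos (mul_nonneg hα0 (hx a).le) (mul_pos hβ (hx w))
  refine ofReal_lt_alphaSpectralRadius hl x ?_ ⟨v, ?_⟩
  · simp only [h.alphaOp_eq, mul_add, mul_sub, sum_add_distrib, sum_sub_distrib, mul_ite, mul_zero,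
      hxl, Finset.sum_ite_eq', Finset.mem_univ, if_true]
    have h1 : ∑ w ∈ S, x v * (α * x v + (1 - α) * x w) ≤
        ∑ w ∈ S, x u * (α * x u + (1 - α) * x w) := by
      refine sum_le_sum fun w _ => mul_le_mul hvu ?_ (hterm _ _).le (hx u).le
      have := mul_le_mul_of_nonneg_left hvu hα0
      linarith
    simp only [← mul_sum] at h1
    have h2 : 0 ≤ ∑ i, if i ∈ S then x i * ((1 - α) * x u) - x i * ((1 - α) * x v) else 0 := by
      refine sum_nonneg fun i _ => ?_
      split_ifs
      · have := mul_le_mul_of_nonneg_left (mul_le_mul_of_nonneg_left hvu hβ.le) (hx i).le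
        linarith
      · exact le_rfl
    simp only [sum_add_distrib, mul_add] at h1 h2 ⊢
    linarith
  · rw [h.alphaOp_eq, hxl]
    simp only [huv, if_false, hvS, if_true]
    have : 0 < ∑ w ∈ S, (α * x v + (1 - α) * x w) := sum_pos (fun w _ => hterm _ _) hS
    intro h'
    linarith

end Move

/-! ### Connectedness and diameter after moving edges -/

section Diameter

variable {V : Type*} {G G' : SimpleGraph V} {u v : V} {S : Finset V}

lemma connected_of_adj_reachable (hG : G.Connected)
    (h : ∀ x y, G.Adj x y → G'.Reachable x y) : G'.Connected := by
  have := hG.nonempty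
  refine ⟨fun x y => ?_⟩
  obtain ⟨p⟩ := hG.preconnected x y
  induction p with
  | nil => exact SimpleGraph.Reachable.refl _
  | cons hadj _ ih => exact (h _ _ hadj).trans ih

/-- Moving edges between two adjacent vertices preserves connectedness. -/
lemma connected_moveEdges_of_adj (hG : G.Connected) (huv : G.Adj v u) (huS : u ∉ S) :
    (moveEdges G v u S).Connected := by
  have hvu : (moveEdges G v u S).Reachable v u := by
    by_cases hv : v ∈ S
    · exact SimpleGraph.Adj.reachable ⟨huv.ne, by tauto⟩
    · exact SimpleGraph.Adj.reachable ⟨huv.ne, Or.inl ⟨huv, by tauto, by tauto⟩⟩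
  have hS : ∀ w ∈ S, (moveEdges G v u S).Reachable v w := fun w hw =>
    hvu.trans (SimpleGraph.Adj.reachable ⟨fun h => huS (h ▸ hw), Or.inr (Or.inl ⟨rfl, hw⟩)⟩)
  refine connected_of_adj_reachable hG fun x y hxy => ?_
  by_cases h1 : x = v ∧ y ∈ S
  · rw [h1.1]; exact hS y h1.2
  by_cases h2 : y = v ∧ x ∈ S
  · rw [h2.1]; exact (hS x h2.2).symm
  exact SimpleGraph.Adj.reachable ⟨hxy.ne, Or.inl ⟨hxy, h1, h2⟩⟩

/-- A pendant vertex `a` of a connected graph can be hung at any other vertex `s`. -/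
lemma exists_isMove_leaf {a b s : V} (hG : G.Connected) (hab : G.Adj a b)
    (hleaf : ∀ y, G.Adj a y → y = b) (hsa : s ≠ a) :
    ∃ K : SimpleGraph V, IsMove G K b s {a} ∧ K.Connected ∧ K.Adj a s ∧
      (∀ y, K.Adj a y → y = s) ∧ (∀ i j, i ≠ a → j ≠ a → (K.Adj i j ↔ G.Adj i j)) := by
  by_cases hsb : s = b
  · subst hsb
    exact ⟨G, isMove_refl _ _ _, hG, hab, hleaf, fun i j _ _ => Iff.rfl⟩
  have hm : IsMove G (moveEdges G b s {a}) b s {a} := by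
    refine isMove_moveEdges (Ne.symm hsb) ?_ ?_ ?_
    · intro w hw; rw [mem_singleton.1 hw]; exact hab.symm
    · intro w hw h; rw [mem_singleton.1 hw] at h; exact hsb (hleaf _ h.symm)
    · rw [mem_singleton]; exact hsa
  have hadj : ∀ i j, i ≠ a → j ≠ a → ((moveEdges G b s {a}).Adj i j ↔ G.Adj i j) :=
    fun i j hi hj => hm.adj_iff (by simpa using hi) (by simpa using hj)
  have has : (moveEdges G b s {a}).Adj a s := ⟨hsa.symm, by simp⟩
  refine ⟨_, hm, ?_, has, ?_, hadj⟩
  · have : Fintype (G.neighborSet a) :=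
      Fintype.ofEquiv ({b} : Set V) (Equiv.setCongr (by
        ext y; exact ⟨fun h => by rw [Set.mem_singleton_iff.1 h]; exact hab, fun h => hleaf y h⟩))
    have hdeg : G.degree a = 1 := by
      rw [SimpleGraph.degree_eq_one_iff_existsUnique_adj]
      exact ⟨b, hab, hleaf⟩
    have hc := hG.induce_compl_singleton_of_degree_eq_one hdeg
    let f : G.induce {a}ᶜ →g moveEdges G b s {a} :=
      ⟨Subtype.val, fun {x y} h => (hadj _ _ x.2 y.2).2 h⟩
    have hs : ∀ x, (moveEdges G b s {a}).Reachable x s := by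
      intro x
      by_cases hx : x = a
      · rw [hx]; exact has.reachable
      · exact (hc.preconnected ⟨x, hx⟩ ⟨s, hsa⟩).map f
    have := hG.nonempty
    exact ⟨fun x y => (hs x).trans (hs y).symm⟩
  · rintro y ⟨hne, h | h | h⟩
    · exact absurd ⟨hleaf y h.1, mem_singleton_self a⟩ h.2.2
    · exact absurd h.1.symm hsa
    · exact h.1

lemma le_add_length {g : V → ℕ} (hg : ∀ i j, G.Adj i j → g j ≤ g i + 1) {x y : V}
    (p : G.Walk x y) : g y ≤ g x + p.length := by
  induction p with
  | nil => simp
  | cons hadj _ ih =>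
    have := hg _ _ hadj
    rw [SimpleGraph.Walk.length_cons]
    omega

lemma dist_le_diam_of_connected [Finite V] (hG : G.Connected) (x y : V) :
    G.dist x y ≤ G.diam := by
  have := hG.nonempty
  exact SimpleGraph.dist_le_diam (SimpleGraph.connected_iff_ediam_ne_top.1 hG)

/-- A function which changes by at most one along every edge certifies a lower bound for the
diameter. -/
lemma le_diam_of_lipschitz [Finite V] (hG : G.Connected) {g : V → ℕ} {d : ℕ}
    (hg : ∀ i j, G.Adj i j → g j ≤ g i + 1) {x y : V} (hxy : g x + d ≤ g y) : d ≤ G.diam := by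
  obtain ⟨p, hp⟩ := hG.exists_walk_length_eq_dist x y
  have h1 := le_add_length hg p
  have h2 := dist_le_diam_of_connected hG x y
  omega

lemma dist_le_dist_add_one (hG : G.Connected) (r : V) (i j : V) (h : G.Adj i j) :
    G.dist r j ≤ G.dist r i + 1 := by
  have h1 := hG.dist_triangle (u := r) (v := i) (w := j)
  rwa [SimpleGraph.dist_eq_one_iff_adj.2 h] at h1

/-- Identifying the ends of an edge lowers a distance by at most one: the distances from `r` can be
modified, by merging two consecutive levels, to a function which changes by at most one along edges
and takes the same value at both ends of the given edge. -/
lemma exists_lipschitz_merge (hG : G.Connected) {a b : V} (hab : G.Adj a b) (r s : V) :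
    ∃ g : V → ℕ, (∀ i j, G.Adj i j → g j ≤ g i + 1) ∧ g a = g b ∧ g r = 0 ∧
      G.dist r s ≤ g s + 1 := by
  have hf := dist_le_dist_add_one hG r
  rcases eq_or_ne (G.dist r a) (G.dist r b) with h | h
  · exact ⟨G.dist r, hf, h, by simp, by omega⟩
  have h1 := hf a b hab
  have h2 := hf b a hab.symm
  refine ⟨fun x => if G.dist r x ≤ min (G.dist r a) (G.dist r b) then G.dist r x
    else G.dist r x - 1, ?_, ?_, ?_, ?_⟩
  · intro i j hij
    have := hf i j hij
    dsimp only
    split_ifs <;> omega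
  · dsimp only
    split_ifs <;> omega
  · simp
  · dsimp only
    split_ifs <;> omega

lemma IsTCyclic.of_isMove [Fintype V] {t : ℕ} (hG : IsTCyclic t G) (h : IsMove G G' v u S)
    (hc : G'.Connected) : IsTCyclic t G' :=
  ⟨hc, by rw [h.ncard_edgeSet]; exact hG.2⟩

end Diameter

/-! ### Extremality among graphs of at least the given diameter -/

section Extremal

variable {V : Type*} {G : SimpleGraph V} {u v : V} {S : Finset V}

lemma lipschitz_moveEdges {g : V → ℕ} (hg : ∀ i j, G.Adj i j → g j ≤ g i + 1)
    (hv : ∀ w ∈ S, G.Adj v w) (hvu : g v = g u) (i j : V) (h : (moveEdges G v u S).Adj i j) :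
    g j ≤ g i + 1 := by
  rcases h.2 with h | ⟨rfl, h'⟩ | ⟨rfl, h'⟩
  · exact hg _ _ h.1
  · rw [← hvu]; exact hg _ _ (hv _ h')
  · rw [← hvu]; exact hg _ _ (hv _ h').symm

lemma diam_le_diam_moveEdges_add_one [Finite V] (hG : G.Connected) (huv : G.Adj v u)
    (hv : ∀ w ∈ S, G.Adj v w) (huS : u ∉ S) : G.diam ≤ (moveEdges G v u S).diam + 1 := by
  have := hG.nonempty
  obtain ⟨r, s, hrs⟩ := SimpleGraph.exists_dist_eq_diam (G := G)
  obtain ⟨g, hg, hgvu, hgr, hgs⟩ := exists_lipschitz_merge hG huv r s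
  have h := le_diam_of_lipschitz (connected_moveEdges_of_adj hG huv huS)
    (lipschitz_moveEdges hg hv hgvu) (x := r) (y := s) (d := g s) (by omega)
  omega

/-- Two adjacent vertices of a graph of diameter at least three neither of which dominates the
other, namely the two middle vertices of a path of length three on a geodesic. -/
lemma exists_adj_not_nested [Finite V] (hG : G.Connected) (hd : 3 ≤ G.diam) :
    ∃ a b c e, G.Adj a b ∧ G.Adj a c ∧ ¬G.Adj b c ∧ c ≠ b ∧ G.Adj b e ∧ ¬G.Adj a e ∧ e ≠ a := by
  have := hG.nonempty
  obtain ⟨r, s, hrs⟩ := SimpleGraph.exists_dist_eq_diam (G := G)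
  obtain ⟨p, hp⟩ := hG.exists_walk_length_eq_dist r s
  have hlen : 3 ≤ p.length := by omega
  match p, hp, hlen with
  | @SimpleGraph.Walk.cons _ _ _ v1 _ h01 (@SimpleGraph.Walk.cons _ _ _ v2 _ h12
      (@SimpleGraph.Walk.cons _ _ _ v3 _ h23 q)), hp, _ =>
    simp only [SimpleGraph.Walk.length_cons] at hp
    have hnot : ∀ q' : G.Walk r s, q.length + 3 ≤ q'.length := fun q' => by
      have := SimpleGraph.dist_le q'
      omega
    refine ⟨v1, v2, r, v3, h12, h01.symm, fun h => ?_, ?_, h23, fun h => ?_, ?_⟩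
    · have := hnot (.cons h.symm (.cons h23 q))
      simp only [SimpleGraph.Walk.length_cons] at this
      omega
    · rintro rfl
      have := hnot (.cons h23 q)
      simp only [SimpleGraph.Walk.length_cons] at this
      omega
    · have := hnot (.cons h01 (.cons h q))
      simp only [SimpleGraph.Walk.length_cons] at this
      omega
    · rintro rfl
      have := hnot (.cons h01 q)
      simp only [SimpleGraph.Walk.length_cons] at this
      omega

/-- If neither of two adjacent vertices dominates the other, the private neighbours of the one with
the smaller Perron entry can be moved to the other: the spectral radius increases, while the
diameter drops by at most one. -/
lemma exists_lt_of_not_nested [Fintype V] {α : ℝ} {t : ℕ} (hα0 : 0 ≤ α) (hα1 : α < 1)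
    (hG : IsTCyclic t G) {a b c e : V} (hab : G.Adj a b) (hac : G.Adj a c) (hbc : ¬G.Adj b c)
    (hcb : c ≠ b) (hbe : G.Adj b e) (hae : ¬G.Adj a e) (hea : e ≠ a) :
    ∃ K : SimpleGraph V, IsTCyclic t K ∧ G.diam ≤ K.diam + 1 ∧
      alphaSpectralRadius α G < alphaSpectralRadius α K := by
  classical
  have := hG.1.nonempty
  obtain ⟨l, x, hl, hx, hxl, hrad⟩ := exists_perron hα0 hα1 hG.1
  wlog hle : x a ≤ x b generalizing a b c e
  · exact this hab.symm hbe hae hea hac hbc hcb (le_of_not_ge hle)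
  let S : Finset V := univ.filter fun w => G.Adj a w ∧ ¬G.Adj b w ∧ w ≠ b
  have hSa : ∀ w ∈ S, G.Adj a w := fun w hw => (mem_filter.1 hw).2.1
  have hbS : b ∉ S := fun h => (mem_filter.1 h).2.2.2 rfl
  have hm : IsMove G (moveEdges G a b S) a b S :=
    isMove_moveEdges hab.ne hSa (fun w hw => (mem_filter.1 hw).2.2.1) hbS
  refine ⟨_, hG.of_isMove hm (connected_moveEdges_of_adj hG.1 hab hbS),
    diam_le_diam_moveEdges_add_one hG.1 hab hSa hbS, ?_⟩
  rw [hrad]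
  exact hm.ofReal_lt hα0 hα1 hl hx hxl hab.ne (fun h => (hSa a h).ne rfl)
    ⟨c, mem_filter.2 ⟨mem_univ _, hac, hbc, hcb⟩⟩ hle

variable {α : ℝ} {t n d : ℕ}

/-- A graph with maximal spectral radius in diameter `d ≥ 2` is also maximal among the graphs of
diameter at least `d`: a maximal graph of diameter greater than `d` could be improved at the cost of
lowering its diameter by one. -/
lemma IsExtremal.radius_le {G : SimpleGraph (Fin n)} (hα0 : 0 ≤ α) (hα1 : α < 1)
    (hG : IsExtremal α t n d G) (hd : 2 ≤ d) {K : SimpleGraph (Fin n)} (hK : IsTCyclic t K)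
    (hKd : d ≤ K.diam) : alphaSpectralRadius α K ≤ alphaSpectralRadius α G := by
  obtain ⟨K', hK', hmax⟩ := Set.exists_max_image
    {H : SimpleGraph (Fin n) | IsTCyclic t H ∧ d ≤ H.diam} (alphaSpectralRadius α)
    (Set.toFinite _) ⟨K, hK, hKd⟩
  refine (hmax K ⟨hK, hKd⟩).trans (hG.2 K' ⟨hK'.1, ?_⟩)
  by_contra hne
  have hlt : d < K'.diam := lt_of_le_of_ne hK'.2 (Ne.symm hne)
  obtain ⟨a, b, c, e, hab, hac, hbc, hcb, hbe, hae, hea⟩ :=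
    exists_adj_not_nested hK'.1.1 (by omega)
  obtain ⟨H, hH, hHd, hlt'⟩ :=
    exists_lt_of_not_nested hα0 hα1 hK'.1 hab hac hbc hcb hbe hae hea
  exact absurd (hmax H ⟨hH, by omega⟩) (not_le.2 hlt')

end Extremal

/-! ### Contracting an edge that lies in no triangle -/

section Contract

/-- The edge `ab` is contracted to `b`, and the vertex `a` is reused as a new pendant vertex, hung
at a vertex `s` chosen so that the diameter does not drop: contraction lowers the diameter by at
most one, and the pendant vertex at the far end of a longest geodesic restores it. -/
lemma exists_contract {V : Type*} [Finite V] {G : SimpleGraph V} (hG : G.Connected) {a b : V}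
    {S : Finset V} (hab : G.Adj a b) (htri : ∀ y, G.Adj a y → ¬G.Adj b y)
    (hS : ∀ w, w ∈ S ↔ G.Adj a w ∧ w ≠ b) :
    ∃ (K₁ K : SimpleGraph V) (s : V), IsMove G K₁ a b S ∧ IsMove K₁ K b s {a} ∧ K.Connected ∧
      G.diam ≤ K.diam ∧ K.Adj a s := by
  classical
  have := hG.nonempty
  have hbS : b ∉ S := fun h => ((hS b).1 h).2 rfl
  have haS : a ∉ S := fun h => ((hS a).1 h).1.ne rfl
  have hSa : ∀ w ∈ S, G.Adj a w := fun w hw => ((hS w).1 hw).1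
  have hm : IsMove G (moveEdges G a b S) a b S :=
    isMove_moveEdges hab.ne hSa (fun w hw => htri w (hSa w hw)) hbS
  have hc := connected_moveEdges_of_adj hG hab hbS
  have hK₁ab : (moveEdges G a b S).Adj a b := ⟨hab.ne, Or.inl ⟨hab, by tauto, by tauto⟩⟩
  have hleaf : ∀ y, (moveEdges G a b S).Adj a y → y = b := by
    rintro y ⟨-, h | h | h⟩
    · by_contra hy
      exact h.2.1 ⟨rfl, (hS y).2 ⟨h.1, hy⟩⟩
    · exact absurd h.1 hab.ne
    · exact h.1
  obtain ⟨r₀, s₀, hrs⟩ := SimpleGraph.exists_dist_eq_diam (G := G)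
  obtain ⟨g, hg, hgab, hgr, hgs⟩ := exists_lipschitz_merge hG hab r₀ s₀
  have hmerge : ∀ y, ∃ y', y' ≠ a ∧ g y' = g y := by
    intro y
    by_cases hy : y = a
    · exact ⟨b, hab.ne.symm, by rw [hy, hgab]⟩
    · exact ⟨y, hy, rfl⟩
  obtain ⟨r, hra, hr⟩ := hmerge r₀
  obtain ⟨s, hsa, hs⟩ := hmerge s₀
  obtain ⟨K, hmK, hKc, hKas, hKleaf, hKadj⟩ := exists_isMove_leaf hc hK₁ab hleaf hsa
  refine ⟨_, K, s, hm, hmK, hKc, ?_, hKas⟩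
  refine le_diam_of_lipschitz hKc (g := Function.update g a (g s + 1)) ?_ (x := r) (y := a) ?_
  · intro i j hij
    by_cases hi : i = a
    · subst hi
      obtain rfl := hKleaf j hij
      rw [Function.update_self, Function.update_of_ne hsa]
      omega
    by_cases hj : j = a
    · subst hj
      obtain rfl := hKleaf i hij.symm
      rw [Function.update_self, Function.update_of_ne hsa]
    rw [Function.update_of_ne hi, Function.update_of_ne hj]
    exact lipschitz_moveEdges hg hSa hgab _ _ ((hKadj i j hi hj).1 hij)
  · rw [Function.update_self, Function.update_of_ne hra]
    omega

/-- Setting the entry of `x` at `a` to zero costs a neighbour `i` of `a` the term `(1 - α) x a`.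
Raising the other entries costs nothing, and a rise at `i` itself is counted here only along the
edge `ia`, which is all that is known about the degree of `i`. -/
lemma le_alphaOp_of_le {V : Type*} [Fintype V] {G : SimpleGraph V} {α : ℝ} (hα0 : 0 ≤ α)
    (hα1 : α < 1) {x z : V → ℝ} {a i : V} (hza : z a = 0) (hz : ∀ j, j ≠ a → x j ≤ z j)
    (hi : i ≠ a) :
    alphaOp α G x i + adjInd G i a * (α * (z i - x i) - (1 - α) * x a) ≤ alphaOp α G z i := by
  classical
  have h1 : adjInd G i a * (α * (z i - x i) - (1 - α) * x a) =
      ∑ j, if j = a then adjInd G i a * (α * (z i - x i) - (1 - α) * x a) else 0 := by simp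
  unfold alphaOp
  rw [h1, ← sum_add_distrib]
  refine sum_le_sum fun j _ => ?_
  split_ifs with hj
  · subst hj
    rw [hza]
    exact le_of_eq (by ring)
  · rw [add_zero]
    refine mul_le_mul_of_nonneg_left ?_ adjInd_nonneg
    have h2 := mul_le_mul_of_nonneg_left (hz i hi) hα0
    have h3 := mul_le_mul_of_nonneg_left (hz j hj) (sub_pos.2 hα1).le
    linarith

variable {α l : ℝ} {t n d : ℕ} {G : SimpleGraph (Fin n)} {x : Fin n → ℝ}

/-- The test vector for the contracted graph is `x`, raised by `ε` on the neighbours of `a` other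
than `b` and set to zero at the pendant vertex `a`. If it were a subsolution also at `b`, the
contracted graph would have larger spectral radius than the extremal graph. -/
lemma IsExtremal.sum_lt_of_contract (hα0 : 0 ≤ α) (hα1 : α < 1) (hG : IsExtremal α t n d G)
    (hd : 2 ≤ d) (hl : 0 ≤ l) (hx : ∀ i, 0 < x i) (hxl : ∀ i, alphaOp α G x i = l * x i)
    (hrad : alphaSpectralRadius α G = ENNReal.ofReal l) {a b : Fin n} {S : Finset (Fin n)}
    (hab : G.Adj a b) (htri : ∀ y, G.Adj a y → ¬G.Adj b y)
    (hS : ∀ w, w ∈ S ↔ G.Adj a w ∧ w ≠ b) {ε : ℝ} (hε : 0 ≤ ε)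
    (hεl : (l - α) * ε ≤ (1 - α) * (x b - x a)) :
    ∑ w ∈ S, (α * x b + (1 - α) * (x w + ε)) < (1 - α) * x a + α * x b := by
  have hβ : 0 < 1 - α := sub_pos.2 hα1
  obtain ⟨K₁, K, s, hm₁, hm, hc, hdiam, has⟩ := exists_contract hG.1.1.1 hab htri hS
  have hKt : IsTCyclic t K :=
    ⟨hc, by rw [hm.ncard_edgeSet, hm₁.ncard_edgeSet]; exact hG.1.1.2⟩
  have hle := hG.radius_le hα0 hα1 hd hKt (by rw [← hG.1.2]; exact hdiam)
  by_contra! hcon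
  refine absurd hle (not_le.2 ?_)
  rw [hrad]
  have hbS : b ∉ S := fun h => ((hS b).1 h).2 rfl
  have haS : a ∉ S := fun h => ((hS a).1 h).1.ne rfl
  let z : Fin n → ℝ := fun i => if i = a then 0 else if i ∈ S then x i + ε else x i
  have hza : z a = 0 := by simp [z]
  have hzb : z b = x b := by simp [z, hbS, hab.ne.symm]
  have hzS : ∀ i ∈ S, z i = x i + ε := fun i hi => by
    have : i ≠ a := fun h => haS (h ▸ hi)
    simp [z, hi, this]
  have hzx : ∀ i, i ≠ a → x i ≤ z i := by
    intro i hi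
    by_cases hiS : i ∈ S
    · rw [hzS i hiS]; linarith
    · simp [z, hi, hiS]
  have hz0 : ∀ i, 0 ≤ z i := by
    intro i
    by_cases hi : i = a
    · rw [hi, hza]
    · exact (hx i).le.trans (hzx i hi)
  have hzs : 0 < z s := (hx s).trans_le (hzx s has.ne.symm)
  have hpos : 0 < alphaOp α K z a := by
    refine lt_of_lt_of_le (mul_pos hβ hzs) ?_
    have h1 := single_le_sum (f := fun j => adjInd K a j * (α * z a + (1 - α) * z j))
      (fun j _ => mul_nonneg adjInd_nonneg (add_nonneg (mul_nonneg hα0 (hz0 a))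
        (mul_nonneg hβ.le (hz0 j)))) (mem_univ s)
    simpa [alphaOp, adjInd_of_adj has, hza] using h1
  refine ofReal_lt_alphaSpectralRadius_of_le hl z hz0 ?_ ⟨a, by rw [hza, mul_zero]; exact hpos.ne'⟩
  intro i
  by_cases hia : i = a
  · rw [hia, hza, mul_zero]; exact hpos.le
  have hlow := le_alphaOp_of_le (G := G) hα0 hα1 hza hzx hia
  rw [hxl] at hlow
  have hKi : alphaOp α K₁ z i - (if i = b then α * z b else 0) ≤ alphaOp α K z i := by
    rw [hm.alphaOp_eq]
    simp only [sum_singleton, hza, mul_zero, add_zero, mem_singleton, hia, if_false]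
    have h1 : 0 ≤ if i = s then α * z s else 0 := by
      split_ifs
      · exact mul_nonneg hα0 (hz0 s)
      · exact le_rfl
    linarith
  refine le_trans ?_ hKi
  rw [hm₁.alphaOp_eq]
  simp only [hia, if_false, sub_zero, hza]
  by_cases hib : i = b
  · subst hib
    rw [adjInd_of_adj hab.symm, hzb] at hlow
    simp only [if_true, hbS, if_false, hzb]
    have h2 : ∑ w ∈ S, (α * x i + (1 - α) * z w) = ∑ w ∈ S, (α * x i + (1 - α) * (x w + ε)) :=
      sum_congr rfl fun w hw => by rw [hzS w hw]
    rw [h2]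
    linarith
  simp only [hib, if_false, sub_zero, add_zero]
  by_cases hiS : i ∈ S
  · rw [adjInd_of_adj ((hS i).1 hiS).1.symm, hzS i hiS] at hlow
    simp only [hiS, if_true, hzb]
    rw [hzS i hiS]
    linarith
  · have h3 : ¬G.Adj i a := fun h => hiS ((hS i).2 ⟨h.symm, hib⟩)
    rw [adjInd_of_not_adj h3] at hlow
    have h4 : z i = x i := by simp [z, hia, hiS]
    simp only [hiS, if_false]
    rw [h4] at hlow ⊢
    linarith

/-- The inequality behind the contraction of an edge `ab` with `x a ≤ x b`, normalised by
`x a = 1`: here `X` is the entry at `b`, `k` the number of other neighbours of `a` and `T` the sum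
of their entries, each of which is at least `σ / k`. -/
lemma one_le_of_contract {b k m σ T X : ℝ} (hb : 0 ≤ b) (hk : 2 ≤ k) (hX : 1 ≤ X) (hσ : 0 < σ)
    (hT : σ ≤ T) (hm : X + T = m) (hσm : σ * (m + b * k) = k) :
    1 ≤ T + σ * (X - 1) + b * (k - 1) * X := by
  by_contra! hcon
  obtain rfl : X = m - T := by linarith
  set B := b * (k - 1) with hB
  have hbB : b ≤ B := by nlinarith
  have hr0 : 0 < σ + B := by linarith
  have hr : σ + B < 1 := by nlinarith
  -- the left-hand side is increasing in `T`, so its value at `T = σ` is also less than one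
  have hmr : (m - σ) * (σ + B) < 1 := by nlinarith
  rcases le_or_gt m 2 with h2 | h2
  · have h3 : k ≤ σ * (2 + b * k) := by nlinarith
    have h4 : σ * (2 + b * k) ≤ (1 - B) * (2 + b * k) :=
      mul_le_mul_of_nonneg_right (by linarith) (by nlinarith)
    have h5 : (1 - B) * (2 + b * k) = k - (k - 2) * (1 + b) - B * (b * k) := by
      rw [hB]; ring
    have h6 : 0 ≤ B * (b * k) := mul_nonneg (hb.trans hbB) (mul_nonneg hb (by linarith))
    have h7 : 0 ≤ (k - 2) * (1 + b) := mul_nonneg (by linarith) (by linarith)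
    have h8 : σ * (2 + b * k) < (1 - B) * (2 + b * k) :=
      mul_lt_mul_of_pos_right (by linarith) (by nlinarith)
    linarith
  · have h3 : (m - σ) * (σ + B) = k - (b * k) * σ - σ * σ + B * (m - σ) := by
      linear_combination hσm
    have h4 : B * (2 - σ) ≤ B * (m - σ) :=
      mul_le_mul_of_nonneg_left (by linarith) (hb.trans hbB)
    have h5 : b * k = B + b := by rw [hB]; ring
    have h6 : σ * σ ≤ (1 - B) * (1 - B) := mul_self_le_mul_self hσ.le (by linarith)
    have h7 : (B + b) * σ ≤ (B + B) * (1 - B) :=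
      mul_le_mul (by linarith) (by linarith) hσ.le (by linarith)
    have h8 : B * σ ≤ B * (1 - B) := mul_le_mul_of_nonneg_left (by linarith) (hb.trans hbB)
    rw [h5] at h3
    nlinarith

/-- In an extremal graph, let `ab` be an edge in no triangle with `x a ≤ x b`. Then `a` has at most
one further neighbour, and the Perron entry there is smaller than `x a`. -/
lemma IsExtremal.lt_of_adj (hα0 : 0 ≤ α) (hα1 : α < 1) (hG : IsExtremal α t n d G)
    (hd : 2 ≤ d) (hl : 0 ≤ l) (hx : ∀ i, 0 < x i) (hxl : ∀ i, alphaOp α G x i = l * x i)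
    (hrad : alphaSpectralRadius α G = ENNReal.ofReal l) {a b c : Fin n}
    (hab : G.Adj a b) (htri : ∀ y, G.Adj a y → ¬G.Adj b y) (hle : x a ≤ x b)
    (hac : G.Adj a c) (hcb : c ≠ b) :
    x c < x a ∧ ∀ y, G.Adj a y → y = b ∨ y = c := by
  classical
  have hβ : 0 < 1 - α := sub_pos.2 hα1
  let S : Finset (Fin n) := univ.filter fun w => G.Adj a w ∧ w ≠ b
  have hS : ∀ w, w ∈ S ↔ G.Adj a w ∧ w ≠ b := fun w => by simp [S]
  have hbS : b ∉ S := fun h => ((hS b).1 h).2 rfl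
  have hcS : c ∈ S := (hS c).2 ⟨hac, hcb⟩
  have hsum : ∀ y, l * x y = ∑ w ∈ univ.filter (fun w => G.Adj y w),
      (α * x y + (1 - α) * x w) := by
    intro y
    rw [← hxl, alphaOp, sum_filter]
    refine sum_congr rfl fun w _ => ?_
    split_ifs with h
    · rw [adjInd_of_adj h, one_mul]
    · rw [adjInd_of_not_adj h, zero_mul]
  have hterm : ∀ y w, 0 ≤ α * x y + (1 - α) * x w := fun y w =>
    add_nonneg (mul_nonneg hα0 (hx y).le) (mul_nonneg hβ.le (hx w).le)
  have hcard : #S ≤ 1 := by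
    by_contra! h2
    have hnb : ∀ w ∈ S, (1 - α) * x a ≤ (l - α) * x w := by
      intro w hw
      have h1 := single_le_sum (f := fun j => α * x w + (1 - α) * x j) (fun j _ => hterm w j)
        (mem_filter.2 ⟨mem_univ a, ((hS w).1 hw).1.symm⟩)
      rw [← hsum] at h1
      linarith
    have hL : 0 < l - α := by
      by_contra! h3
      have h4 := mul_pos hβ (hx a)
      have h5 := mul_nonneg (neg_nonneg.2 h3) (hx c).le
      linarith [hnb c hcS]
    have hfil : univ.filter (fun w => G.Adj a w) = insert b S := by
      ext w
      by_cases hw : w = b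
      · simp [hw, hab]
      · simp [hS, hw]
    have hT : (#S : ℝ) * ((1 - α) * x a) ≤ (l - α) * ∑ w ∈ S, x w := by
      rw [mul_sum, ← nsmul_eq_mul]
      exact card_nsmul_le_sum _ _ _ hnb
    have heq := hsum a
    rw [hfil, sum_insert hbS, sum_add_distrib, sum_const, nsmul_eq_mul, ← mul_sum] at heq
    have hk : (2 : ℝ) ≤ #S := by exact_mod_cast h2
    set k : ℝ := (#S : ℝ) with hkdef
    set T : ℝ := ∑ w ∈ S, x w with hTdef
    have hxa := hx a
    have hmain := one_le_of_contract (b := α / (1 - α)) (k := k)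
      (m := (l - α * (k + 1)) / (1 - α)) (σ := k * (1 - α) / (l - α)) (T := T / x a)
      (X := x b / x a) (div_nonneg hα0 hβ.le) hk ((one_le_div hxa).2 hle)
      (div_pos (mul_pos (by linarith) hβ) hL)
      (by rw [div_le_div_iff₀ hL hxa]; linarith)
      (by field_simp; linarith)
      (by field_simp; ring)
    -- the largest `ε` for which the test vector is a subsolution at the neighbours of `a`
    have hlt := hG.sum_lt_of_contract hα0 hα1 hd hl hx hxl hrad hab htri hS
      (ε := (1 - α) * (x b - x a) / (l - α))
      (div_nonneg (mul_nonneg hβ.le (sub_nonneg.2 hle)) hL.le)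
      (le_of_eq (mul_div_cancel₀ _ hL.ne'))
    rw [sum_add_distrib, sum_const, nsmul_eq_mul, ← mul_sum, sum_add_distrib, sum_const,
      nsmul_eq_mul, ← hkdef, ← hTdef] at hlt
    have h6 := mul_le_mul_of_nonneg_left hmain (mul_pos hβ hxa).le
    have h7 : (1 - α) * x a * (T / x a + k * (1 - α) / (l - α) * (x b / x a - 1) +
        α / (1 - α) * (k - 1) * (x b / x a)) =
        k * (α * x b) + (1 - α) * (T + k * ((1 - α) * (x b - x a) / (l - α))) - α * x b := by
      field_simp
      ring
    rw [h7] at h6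
    linarith
  have huniq : ∀ y ∈ S, y = c := fun y hy => card_le_one.1 hcard y hy c hcS
  refine ⟨?_, fun y hy => ?_⟩
  · have hSc : S = {c} := eq_singleton_iff_unique_mem.2 ⟨hcS, huniq⟩
    have hlt := hG.sum_lt_of_contract hα0 hα1 hd hl hx hxl hrad hab htri hS (le_refl 0)
      (by rw [mul_zero]; exact mul_nonneg hβ.le (sub_nonneg.2 hle))
    rw [hSc, sum_singleton, add_zero] at hlt
    exact lt_of_mul_lt_mul_left (by linarith) hβ.le
  · by_cases hyb : y = b
    · exact Or.inl hyb
    · exact Or.inr (huniq y ((hS y).2 ⟨hy, hyb⟩))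

end Contract

/-! ### Perron weights of extremal graphs and internal paths -/

section Weight

/-- The two properties of the Perron vector `x` of an extremal graph on which the combinatorial part
of the argument rests. The first says that at the lower end `a` of an edge `ab` in no triangle there
is at most one further edge, and it leads further down. The second says that the neighbour of a
pendant vertex avoided by some diametral pair has the largest entry off that pendant vertex. -/
structure IsExtremalWeight {V : Type*} (G : SimpleGraph V) (x : V → ℝ) : Prop where
  lt_of_adj : ∀ {a b c : V}, G.Adj a b → (∀ y, G.Adj a y → ¬G.Adj b y) → x a ≤ x b →
    G.Adj a c → c ≠ b → x c < x a ∧ ∀ y, G.Adj a y → y = b ∨ y = c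
  lt_of_leaf : ∀ {a b w r s : V}, G.Adj a b → (∀ y, G.Adj a y → y = b) → G.dist r s = G.diam →
    r ≠ a → s ≠ a → w ≠ a → w ≠ b → x w < x b

lemma IsExtremal.exists_isExtremalWeight {α : ℝ} {t n d : ℕ} {G : SimpleGraph (Fin n)}
    (hα0 : 0 ≤ α) (hα1 : α < 1) (hG : IsExtremal α t n d G) (hd : 2 ≤ d) :
    ∃ x : Fin n → ℝ, IsExtremalWeight G x := by
  have := hG.1.1.1.nonempty
  obtain ⟨l, x, hl, hx, hxl, hrad⟩ := exists_perron hα0 hα1 hG.1.1.1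
  refine ⟨x, fun hab htri hle hac hcb =>
    hG.lt_of_adj hα0 hα1 hd hl hx hxl hrad hab htri hle hac hcb, ?_⟩
  intro a b w r s hab hleaf hrs hr hs hwa hwb
  by_contra! hle
  obtain ⟨K, hm, hc, hKaw, hKleaf, hKadj⟩ := exists_isMove_leaf hG.1.1.1 hab hleaf hwa
  have hlt := hm.ofReal_lt hα0 hα1 hl hx hxl hwb.symm (by simpa using hab.ne.symm)
    (singleton_nonempty a) hle
  rw [← hrad] at hlt
  refine absurd (hG.radius_le hα0 hα1 hd (hG.1.1.of_isMove hm hc) ?_) (not_le.2 hlt)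
  rw [← hG.1.2, ← hrs]
  -- distances from `r` certify the diameter once `a` is put on the level of its new neighbour
  refine le_diam_of_lipschitz hc (g := Function.update (G.dist r) a (G.dist r w)) ?_
    (x := r) (y := s) ?_
  · intro i j hij
    by_cases hi : i = a
    · subst hi
      obtain rfl := hKleaf j hij
      rw [Function.update_self, Function.update_of_ne hwa]
      omega
    by_cases hj : j = a
    · subst hj
      obtain rfl := hKleaf i hij.symm
      rw [Function.update_self, Function.update_of_ne hwa]
      omega
    rw [Function.update_of_ne hi, Function.update_of_ne hj]
    exact dist_le_dist_add_one hG.1.1.1 r _ _ ((hKadj i j hi hj).1 hij)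
  · rw [Function.update_of_ne hr, Function.update_of_ne hs, SimpleGraph.dist_self]
    omega

variable {V : Type*} {G : SimpleGraph V} {x : V → ℝ}

/-- At the lower end `a` of an edge `ab` in no triangle, the further edge `ca` is in no triangle
either. -/
lemma IsExtremalWeight.descend (hw : IsExtremalWeight G x) {a b c : V} (hab : G.Adj a b)
    (htri : ∀ y, G.Adj a y → ¬G.Adj b y) (hle : x a ≤ x b) (hac : G.Adj a c) (hcb : c ≠ b) :
    x c < x a ∧ ∀ y, G.Adj c y → ¬G.Adj a y := by
  obtain ⟨h1, h2⟩ := hw.lt_of_adj hab htri hle hac hcb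
  refine ⟨h1, fun y hcy hay => ?_⟩
  rcases h2 y hay with rfl | rfl
  · exact htri c hac hcy.symm
  · exact hcy.ne rfl

/-- An edge of a walk with internal degrees is in a triangle: otherwise descending along the walk
from such an edge never stops. -/
lemma IsExtremalWeight.inTriangle_of_walk [Fintype V] (hw : IsExtremalWeight G x) {u v : V}
    {p : G.Walk u v} (hp : HasInternalDegrees G p)
    (hint : ∀ a ∈ p.support, a ≠ u → a ≠ v → (p.toSubgraph.neighborSet a).ncard = 2)
    {e : Sym2 V} (he : e ∈ p.edges) : InTriangle G e := by
  classical
  by_contra hcon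
  let T : Finset V := univ.filter fun a => ∃ b, s(a, b) ∈ p.edges ∧
    (∀ y, G.Adj a y → ¬G.Adj b y) ∧ x a ≤ x b
  have hT : T.Nonempty := by
    induction e using Sym2.ind with | _ a b
    have hadj : G.Adj a b := p.adj_of_mem_edges he
    have htri : ∀ y, G.Adj a y → ¬G.Adj b y := fun y h1 h2 =>
      hcon ⟨a, b, y, hadj, h2, h1.symm, rfl⟩
    rcases le_total (x a) (x b) with h | h
    · exact ⟨a, by simpa [T] using ⟨b, he, htri, h⟩⟩
    · exact ⟨b, by simpa [T] using ⟨a, by rwa [Sym2.eq_swap], fun y h1 h2 => htri y h2 h1, h⟩⟩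
  obtain ⟨a, haT, hmin⟩ := exists_min_image T x hT
  obtain ⟨b, hab, htri, hle⟩ := (mem_filter.1 haT).2
  have hadj : G.Adj a b := p.adj_of_mem_edges hab
  have hcard : ¬3 ≤ (G.neighborSet a).ncard := by
    intro h3
    obtain ⟨c, hc, hcb⟩ := Set.exists_ne_of_one_lt_ncard
      (show 1 < (G.neighborSet a).ncard by omega) b
    have h2 := (hw.lt_of_adj hadj htri hle hc hcb).2
    have h4 : (G.neighborSet a).ncard ≤ ({b, c} : Set V).ncard :=
      Set.ncard_le_ncard (fun y hy => h2 y hy) (Set.toFinite _)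
    have h5 := Set.ncard_insert_le b {c}
    rw [Set.ncard_singleton] at h5
    omega
  have hau : a ≠ u := fun h => hcard (h ▸ hp.1)
  have hav : a ≠ v := fun h => hcard (h ▸ hp.2.1)
  have h2 := hint a (p.fst_mem_support_of_mem_edges hab) hau hav
  obtain ⟨c, hc, hcb⟩ := Set.exists_ne_of_one_lt_ncard
    (show 1 < (p.toSubgraph.neighborSet a).ncard by omega) b
  have hcp : s(a, c) ∈ p.edges := by
    rw [← SimpleGraph.Walk.mem_edges_toSubgraph]; exact hc
  obtain ⟨hlt, htri'⟩ := hw.descend hadj htri hle (p.adj_of_mem_edges hcp) hcb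
  have := hmin c (mem_filter.2 ⟨mem_univ _, a, by rwa [Sym2.eq_swap], htri', hlt.le⟩)
  linarith

lemma IsExtremalWeight.inTriangle [Fintype V] (hw : IsExtremalWeight G x) {e : Sym2 V}
    (he : IsInternalPathEdge G e) : InTriangle G e := by
  rcases he with ⟨u, v, p, hp, hd, he⟩ | ⟨u, p, hp, hd, he⟩
  · refine hw.inTriangle_of_walk hd (fun a ha hau hav => ?_) he
    obtain ⟨i, rfl, hi⟩ := SimpleGraph.Walk.mem_support_iff_exists_getVert.1 ha
    refine hp.ncard_neighborSet_toSubgraph_internal_eq_two ?_ ?_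
    · rintro rfl; exact hau p.getVert_zero
    · refine lt_of_le_of_ne hi ?_
      rintro rfl; exact hav p.getVert_length
  · exact hw.inTriangle_of_walk hd (fun a ha _ _ => hp.ncard_neighborSet_toSubgraph_eq_two ha) he

end Weight

/-! ### The base of a `t`-cyclic graph -/

section Base

variable {V : Type*} {G : SimpleGraph V} {B : G.Subgraph} {t : ℕ}

/-- `G` consists of the subgraph `B` with trees hanging from it: every vertex outside `B` has a
parent, the height `h` of a vertex above `B` exceeds that of its parent by one, and every edge is an
edge of `B` or joins a vertex outside `B` to its parent. -/
structure IsHanging (G : SimpleGraph V) (B : G.Subgraph) (p : V → V) (h : V → ℕ) : Prop where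
  height_base : ∀ v ∈ B.verts, h v = 0
  adj_parent : ∀ v ∉ B.verts, G.Adj v (p v)
  height : ∀ v ∉ B.verts, h v = h (p v) + 1
  adj_cases : ∀ v w, G.Adj v w →
    B.Adj v w ∨ (v ∉ B.verts ∧ w = p v) ∨ (w ∉ B.verts ∧ v = p w)

lemma ncard_edgeSet_coe (B : G.Subgraph) : B.coe.edgeSet.ncard = B.edgeSet.ncard := by
  rw [← SimpleGraph.Subgraph.image_coe_edgeSet_coe B,
    Set.ncard_image_of_injective _ (Sym2.map.injective Subtype.val_injective)]

lemma isTCyclic_coe_iff : IsTCyclic t B.coe ↔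
    B.coe.Connected ∧ B.edgeSet.ncard + 1 = B.verts.ncard + t := by
  rw [IsTCyclic, ncard_edgeSet_coe, Nat.card_coe_set_eq]

/-- A `t`-cyclic subgraph of a `t`-cyclic graph misses as many edges as vertices. Sending each
missed vertex to the first edge of a shortest path to the subgraph is injective on missed vertices,
hence hits all missed edges. -/
lemma exists_isHanging [Finite V] (hG : IsTCyclic t G) (hB : IsTCyclic t B.coe) :
    ∃ p h, IsHanging G B p h := by
  classical
  rw [isTCyclic_coe_iff] at hB
  obtain ⟨⟨b₀, hb₀⟩⟩ := hB.1.nonempty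
  have hex : ∀ v, ∃ k, ∃ b ∈ B.verts, G.dist v b = k := fun v => ⟨_, b₀, hb₀, rfl⟩
  let h : V → ℕ := fun v => Nat.find (hex v)
  have hle : ∀ v, ∀ b ∈ B.verts, h v ≤ G.dist v b := fun v b hb =>
    Nat.find_min' (hex v) ⟨b, hb, rfl⟩
  have hspec : ∀ v, ∃ b ∈ B.verts, G.dist v b = h v := fun v => Nat.find_spec (hex v)
  have hparent : ∀ v, ∃ y, v ∉ B.verts → G.Adj v y ∧ h v = h y + 1 := by
    intro v
    by_cases hv : v ∈ B.verts
    · exact ⟨v, fun h => absurd hv h⟩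
    obtain ⟨b, hb, hvb⟩ := hspec v
    obtain ⟨q, hq⟩ := hG.1.exists_walk_length_eq_dist v b
    cases q with
    | nil => exact absurd hb hv
    | cons hadj q =>
      rename_i y
      refine ⟨y, fun _ => ⟨hadj, ?_⟩⟩
      rw [SimpleGraph.Walk.length_cons] at hq
      have h1 := SimpleGraph.dist_le q
      have h2 := hle y b hb
      obtain ⟨b', hb', hyb'⟩ := hspec y
      have h3 := hle v b' hb'
      have h4 := hG.1.dist_triangle (u := v) (v := y) (w := b')
      rw [SimpleGraph.dist_eq_one_iff_adj.2 hadj] at h4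
      omega
  choose p hp using hparent
  have hbase : ∀ v ∈ B.verts, h v = 0 := fun v hv => by
    have := hle v v hv
    rw [SimpleGraph.dist_self] at this
    omega
  refine ⟨p, h, hbase, fun v hv => (hp v hv).1, fun v hv => (hp v hv).2, ?_⟩
  have hinj : Set.InjOn (fun v => s(v, p v)) B.vertsᶜ := by
    intro v hv w hw hvw
    have hvw : s(v, p v) = s(w, p w) := hvw
    rw [Sym2.eq_iff] at hvw
    rcases hvw with ⟨h1, -⟩ | ⟨h1, h2⟩
    · exact h1
    · have h3 := (hp v hv).2
      have h4 := (hp w hw).2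
      rw [← h1] at h4
      rw [h2] at h3
      omega
  have hsub : (fun v => s(v, p v)) '' B.vertsᶜ ⊆ G.edgeSet \ B.edgeSet := by
    rintro _ ⟨v, hv, rfl⟩
    exact ⟨(hp v hv).1, fun hadj => hv (B.edge_vert hadj)⟩
  have heq := Set.eq_of_subset_of_ncard_le hsub (by
    rw [hinj.ncard_image, Set.ncard_sdiff B.edgeSet_subset, Set.ncard_compl]
    have h1 := hG.2
    have h2 := hB.2
    have h3 : B.verts.ncard ≤ Nat.card V := Set.ncard_le_card _
    omega) (Set.toFinite _)
  intro v w hvw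
  by_cases hBvw : B.Adj v w
  · exact Or.inl hBvw
  have hmem : s(v, w) ∈ G.edgeSet \ B.edgeSet := ⟨hvw, hBvw⟩
  rw [← heq] at hmem
  obtain ⟨y, hy, hyvw⟩ := hmem
  have hyvw : s(y, p y) = s(v, w) := hyvw
  rw [Sym2.eq_iff] at hyvw
  rcases hyvw with ⟨rfl, h2⟩ | ⟨rfl, h2⟩
  · exact Or.inr (Or.inl ⟨hy, h2.symm⟩)
  · exact Or.inr (Or.inr ⟨hy, h2.symm⟩)

/-- The base has minimum degree at least two: a vertex with at most one neighbour in the base could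
be deleted from it. -/
lemma IsBase.exists_adj_ne [Finite V] (ht : 1 ≤ t) (hB : IsBase t G B) {v : V} (hv : v ∈ B.verts)
    (y : V) : ∃ z, B.Adj v z ∧ z ≠ y := by
  classical
  by_contra! hcon
  obtain ⟨hBc, hBe⟩ := isTCyclic_coe_iff.1 hB.1
  by_cases hex : ∃ z, B.Adj v z
  · obtain ⟨z, hvz⟩ := hex
    obtain rfl := hcon z hvz
    let B' := B.deleteVerts {v}
    have hverts : B.verts = insert v B'.verts := by
      ext w
      by_cases hw : w = v <;> simp [B', hw, hv]
    have hedges : B.edgeSet = insert s(v, z) B'.edgeSet := by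
      ext e
      induction e using Sym2.ind with | _ a b
      simp only [SimpleGraph.Subgraph.mem_edgeSet, Set.mem_insert_iff, Sym2.eq_iff, B',
        SimpleGraph.Subgraph.deleteVerts_adj, Set.mem_singleton_iff]
      constructor
      · intro hab
        by_cases ha : a = v
        · subst ha; exact Or.inl (Or.inl ⟨rfl, hcon b hab⟩)
        by_cases hb : b = v
        · subst hb; exact Or.inl (Or.inr ⟨hcon a hab.symm, rfl⟩)
        exact Or.inr ⟨B.edge_vert hab, ha, B.edge_vert hab.symm, hb, hab⟩
      · rintro ((⟨rfl, rfl⟩ | ⟨rfl, rfl⟩) | h)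
        · exact hvz
        · exact hvz.symm
        · exact h.2.2.2.2
    have hvB' : v ∉ B'.verts := by simp [B']
    have heB' : s(v, z) ∉ B'.edgeSet := fun h => hvB' (B'.edge_vert h)
    have hB' : IsTCyclic t B'.coe := by
      rw [isTCyclic_coe_iff]
      constructor
      · have : Fintype (B.coe.neighborSet ⟨v, hv⟩) := Fintype.ofFinite _
        have hdeg : B.coe.degree ⟨v, hv⟩ = 1 := by
          rw [SimpleGraph.degree_eq_one_iff_existsUnique_adj]
          exact ⟨⟨z, B.edge_vert hvz.symm⟩, hvz, fun w hw => Subtype.ext (hcon w hw)⟩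
        have hc := hBc.induce_compl_singleton_of_degree_eq_one hdeg
        have hmem : ∀ w : B.verts, w ≠ ⟨v, hv⟩ → (w : V) ∈ B'.verts := fun w hw => by
          simpa [B'] using fun h => hw (Subtype.ext h)
        let f : B.coe.induce {⟨v, hv⟩}ᶜ →g B'.coe :=
          ⟨fun w => ⟨w.1.1, hmem w.1 w.2⟩, fun {a b} hab => by
            have hab : B.Adj a.1.1 b.1.1 := hab
            have ha : (a.1 : V) ≠ v := fun h => a.2 (Subtype.ext h)
            have hb : (b.1 : V) ≠ v := fun h => b.2 (Subtype.ext h)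
            simp [B', hab, ha, hb]⟩
        refine hc.map f fun w => ?_
        have hw : (w : V) ∈ B.verts := by rw [hverts]; exact Or.inr w.2
        exact ⟨⟨⟨w.1, hw⟩, fun h => hvB' (by
          have : (w : V) = v := congrArg Subtype.val h
          rw [← this]; exact w.2)⟩, rfl⟩
      · rw [hverts, hedges, Set.ncard_insert_of_notMem hvB', Set.ncard_insert_of_notMem heB'] at hBe
        omega
    have hle : B ≤ B' := hB.2 hB' SimpleGraph.Subgraph.deleteVerts_le
    exact hvB' (hle.1 hv)
  · push Not at hex
    -- an isolated vertex of the connected base would be the whole base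
    have hverts : B.verts = {v} := by
      refine Set.eq_singleton_iff_unique_mem.2 ⟨hv, fun w hw => ?_⟩
      obtain ⟨q⟩ := hBc.preconnected ⟨v, hv⟩ ⟨w, hw⟩
      cases q with
      | nil => rfl
      | cons hadj _ => exact absurd hadj (hex _)
    have hedges : B.edgeSet = ∅ := by
      refine Set.eq_empty_iff_forall_notMem.2 fun e => ?_
      induction e using Sym2.ind with | _ a b
      intro hab
      have ha : a ∈ B.verts := B.edge_vert hab
      rw [hverts, Set.mem_singleton_iff] at ha
      subst ha
      exact hex b hab
    rw [hverts, hedges, Set.ncard_empty, Set.ncard_singleton] at hBe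
    omega

variable {p : V → V} {h : V → ℕ}

lemma IsHanging.ne_parent_parent (hH : IsHanging G B p h) {v : V} (hv : v ∉ B.verts)
    (hpv : p v ∉ B.verts) : v ≠ p (p v) := by
  intro heq
  have h1 := hH.height v hv
  have h2 := hH.height _ hpv
  rw [← heq] at h2
  omega

/-- An edge with an end outside the base is in no triangle, as heights differ by one along it. -/
lemma IsHanging.not_adj_of_adj (hH : IsHanging G B p h) {v y : V} (hv : v ∉ B.verts)
    (hvy : G.Adj v y) (w : V) (hvw : G.Adj v w) : ¬G.Adj y w := by
  intro hyw
  have hstep : ∀ a b, G.Adj a b → B.Adj a b ∨ h a = h b + 1 ∨ h b = h a + 1 := by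
    intro a b hab
    rcases hH.adj_cases a b hab with h1 | ⟨h1, rfl⟩ | ⟨h1, rfl⟩
    · exact Or.inl h1
    · exact Or.inr (Or.inl (hH.height a h1))
    · exact Or.inr (Or.inr (hH.height b h1))
  have h1 := (hstep v y hvy).resolve_left fun h => hv (B.edge_vert h)
  have h2 := (hstep v w hvw).resolve_left fun h => hv (B.edge_vert h)
  rcases hstep y w hyw with h3 | h3
  · have hy : y ∈ B.verts := B.edge_vert h3
    have hw : w ∈ B.verts := B.edge_vert h3.symm
    rcases hH.adj_cases v y hvy with h4 | ⟨-, rfl⟩ | ⟨h4, -⟩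
    · exact hv (B.edge_vert h4)
    · rcases hH.adj_cases v w hvw with h5 | ⟨-, rfl⟩ | ⟨h5, -⟩
      · exact hv (B.edge_vert h5)
      · exact hyw.ne rfl
      · exact h5 hw
    · exact h4 hy
  · omega

lemma IsHanging.adj_of_mem (hH : IsHanging G B p h) {v w : V} (hv : v ∈ B.verts)
    (hw : w ∈ B.verts) (hvw : G.Adj v w) : B.Adj v w := by
  rcases hH.adj_cases v w hvw with h1 | ⟨h1, -⟩ | ⟨h1, -⟩
  · exact h1
  · exact absurd hv h1
  · exact absurd hw h1

lemma IsHanging.height_le (hH : IsHanging G B p h) (v w : V) (hvw : G.Adj v w) :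
    h w ≤ h v + 1 := by
  rcases hH.adj_cases v w hvw with h1 | ⟨h1, rfl⟩ | ⟨h1, rfl⟩
  · rw [hH.height_base w (B.edge_vert h1.symm)]; omega
  · have := hH.height v h1; omega
  · exact (hH.height w h1).le

/-- A walk that starts at a descendant of the vertex `u` and avoids `u` stays outside the base. -/
lemma IsHanging.not_mem_of_walk (hH : IsHanging G B p h) {u : V} :
    ∀ {y z : V} (q : G.Walk y z), (∃ k, p^[k] y = u ∧ ∀ j ≤ k, p^[j] y ∉ B.verts) →
      u ∉ q.support → z ∉ B.verts := by
  intro y z q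
  induction q with
  | nil =>
    rintro ⟨k, -, hk⟩ -
    exact hk 0 (Nat.zero_le _)
  | @cons y y' z hadj q ih =>
    rintro ⟨k, hku, hk⟩ hu
    rw [SimpleGraph.Walk.support_cons, List.mem_cons, not_or] at hu
    refine ih ?_ hu.2
    have hy : y ∉ B.verts := hk 0 (Nat.zero_le _)
    rcases hH.adj_cases y y' hadj with h1 | ⟨-, rfl⟩ | ⟨h1, rfl⟩
    · exact absurd (B.edge_vert h1) hy
    · cases k with
      | zero => exact absurd hku.symm hu.1
      | succ k =>
        exact ⟨k, by simpa using hku, fun j hj => by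
          simpa using hk (j + 1) (Nat.succ_le_succ hj)⟩
    · refine ⟨k + 1, by simpa using hku, fun j hj => ?_⟩
      cases j with
      | zero => exact h1
      | succ j => simpa using hk j (Nat.le_of_succ_le_succ hj)

end Base

/-! ### The base of an extremal graph -/

section ExtremalBase

variable {V : Type*} {G : SimpleGraph V} {B : G.Subgraph} {x : V → ℝ} {p : V → V} {h : V → ℕ}

/-- At an edge in no triangle, the end with the smaller weight is a child of the other end:
following the descent of the weights one runs into a tree hanging from the base. -/
lemma IsExtremalWeight.eq_parent [Fintype V] (hw : IsExtremalWeight G x)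
    (hH : IsHanging G B p h) (hmin : ∀ v ∈ B.verts, ∀ y, ∃ z, B.Adj v z ∧ z ≠ y) {a b : V}
    (hab : G.Adj a b) (htri : ∀ y, G.Adj a y → ¬G.Adj b y) (hle : x a ≤ x b) :
    a ∉ B.verts ∧ b = p a := by
  classical
  by_contra hcon
  let T : Finset V := univ.filter fun a => ∃ b, G.Adj a b ∧ (∀ y, G.Adj a y → ¬G.Adj b y) ∧
    x a ≤ x b ∧ ¬(a ∉ B.verts ∧ b = p a)
  obtain ⟨a, haT, hamin⟩ := exists_min_image T x
    ⟨a, mem_filter.2 ⟨mem_univ _, b, hab, htri, hle, hcon⟩⟩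
  obtain ⟨b, hab, htri, hle, hcon⟩ := (mem_filter.1 haT).2
  have hdesc : ∀ c, G.Adj a c → c ≠ b → c ∉ B.verts ∧ a = p c := by
    intro c hac hcb
    obtain ⟨hlt, htri'⟩ := hw.descend hab htri hle hac hcb
    by_contra hc
    have := hamin c (mem_filter.2 ⟨mem_univ _, a, hac.symm, htri', hlt.le, hc⟩)
    linarith
  by_cases ha : a ∈ B.verts
  · obtain ⟨c, hac, hcb⟩ := hmin a ha b
    exact (hdesc c (B.adj_sub hac) hcb).1 (B.edge_vert hac.symm)
  · refine hcon ⟨ha, ?_⟩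
    by_contra hb
    obtain ⟨h1, h2⟩ := hdesc (p a) (hH.adj_parent a ha) (Ne.symm hb)
    exact hH.ne_parent_parent ha h1 h2

/-- Outside the base the Perron weight increases towards the base. -/
lemma IsExtremalWeight.lt_parent [Fintype V] (hw : IsExtremalWeight G x)
    (hH : IsHanging G B p h) (hmin : ∀ v ∈ B.verts, ∀ y, ∃ z, B.Adj v z ∧ z ≠ y) {v : V}
    (hv : v ∉ B.verts) : x v < x (p v) := by
  by_contra! hle
  have hadj := hH.adj_parent v hv
  obtain ⟨h1, h2⟩ := hw.eq_parent hH hmin hadj.symm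
    (fun y h1 h2 => hH.not_adj_of_adj hv hadj y h2 h1) hle
  exact hH.ne_parent_parent hv h1 h2

/-- A vertex outside the base has at most one child. -/
lemma IsExtremalWeight.eq_or_eq_of_adj [Fintype V] (hw : IsExtremalWeight G x)
    (hH : IsHanging G B p h) (hmin : ∀ v ∈ B.verts, ∀ y, ∃ z, B.Adj v z ∧ z ≠ y) {v c : V}
    (hv : v ∉ B.verts) (hvc : G.Adj v c) (hc : c ≠ p v) (z : V) (hz : G.Adj v z) :
    z = p v ∨ z = c :=
  (hw.lt_of_adj (hH.adj_parent v hv) (hH.not_adj_of_adj hv (hH.adj_parent v hv))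
    (hw.lt_parent hH hmin hv).le hvc hc).2 z hz

/-- Every edge of the base is in a triangle of the base. -/
lemma IsExtremalWeight.exists_base_triangle [Fintype V] (hw : IsExtremalWeight G x)
    (hH : IsHanging G B p h) (hmin : ∀ v ∈ B.verts, ∀ y, ∃ z, B.Adj v z ∧ z ≠ y) {a b : V}
    (hab : B.Adj a b) : ∃ c, B.Adj a c ∧ B.Adj b c := by
  have ha := B.edge_vert hab
  have hb := B.edge_vert hab.symm
  have hex : ∃ c, G.Adj a c ∧ G.Adj b c := by
    by_contra! hcon
    rcases le_total (x a) (x b) with hle | hle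
    · exact (hw.eq_parent hH hmin (B.adj_sub hab) hcon hle).1 ha
    · exact (hw.eq_parent hH hmin (B.adj_sub hab).symm (fun y h1 h2 => hcon y h2 h1) hle).1 hb
  obtain ⟨c, hac, hbc⟩ := hex
  have hc : c ∈ B.verts := by
    by_contra hc
    exact hH.not_adj_of_adj hc hac.symm b hbc.symm (B.adj_sub hab)
  exact ⟨c, hH.adj_of_mem ha hc hac, hH.adj_of_mem hb hc hbc⟩

/-- A path outside the base that starts by moving away from the base keeps doing so. -/
lemma IsHanging.height_add_length (hH : IsHanging G B p h) :
    ∀ {y z : V} (q : G.Walk y z) (w : V), w = p y → w ∉ q.support → q.IsPath →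
      (∀ v ∈ q.support, v ∉ B.verts) → h z = h y + q.length := by
  intro y z q
  induction q with
  | nil => intro w _ _ _ _; simp
  | @cons y y' z hadj q ih =>
    intro w hwy hwq hq hB
    rw [SimpleGraph.Walk.cons_isPath_iff] at hq
    simp only [SimpleGraph.Walk.support_cons, List.mem_cons, not_or] at hwq hB
    have hy : y ∉ B.verts := hB y (Or.inl rfl)
    rcases hH.adj_cases y y' hadj with h1 | ⟨-, rfl⟩ | ⟨h1, h2⟩
    · exact absurd (B.edge_vert h1) hy
    · exact absurd (hwy ▸ q.start_mem_support) hwq.2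
    · have h3 := ih y h2 hq.2 hq.1 fun v hv => hB v (Or.inr hv)
      have h4 := hH.height y' h1
      rw [← h2] at h4
      rw [SimpleGraph.Walk.length_cons]
      omega

/-- In an extremal graph, a path outside the base that starts by moving towards the base keeps doing
so, as no vertex outside the base has two children. -/
lemma IsExtremalWeight.height_eq_add_length [Fintype V] (hw : IsExtremalWeight G x)
    (hH : IsHanging G B p h) (hmin : ∀ v ∈ B.verts, ∀ y, ∃ z, B.Adj v z ∧ z ≠ y) :
    ∀ {y z : V} (q : G.Walk y z) (w : V), w ∉ B.verts → y = p w → w ∉ q.support → q.IsPath →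
      (∀ v ∈ q.support, v ∉ B.verts) → h y = h z + q.length := by
  intro y z q
  induction q with
  | nil => intro w _ _ _ _ _; simp
  | @cons y y' z hadj q ih =>
    intro w hwB hyw hwq hq hB
    rw [SimpleGraph.Walk.cons_isPath_iff] at hq
    simp only [SimpleGraph.Walk.support_cons, List.mem_cons, not_or] at hwq hB
    have hy : y ∉ B.verts := hB y (Or.inl rfl)
    have hyw' : G.Adj y w := hyw ▸ (hH.adj_parent w hwB).symm
    have hwp : w ≠ p y := by
      subst hyw
      exact hH.ne_parent_parent hwB hy
    rcases hw.eq_or_eq_of_adj hH hmin hy hyw' hwp y' hadj with h1 | rfl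
    · have h3 := ih y hy h1 hq.2 hq.1 fun v hv => hB v (Or.inr hv)
      have h4 := hH.height y hy
      rw [← h1] at h4
      rw [SimpleGraph.Walk.length_cons]
      omega
    · exact absurd q.start_mem_support hwq.2

/-- A path as long as the diameter meets the base: otherwise it is monotone in the height, and its
upper end is too far from the base. -/
lemma IsExtremalWeight.exists_mem_support [Fintype V] (hw : IsExtremalWeight G x)
    (hG : G.Connected) (hd : 1 ≤ G.diam) (hH : IsHanging G B p h) (hB : B.verts.Nonempty)
    (hmin : ∀ v ∈ B.verts, ∀ y, ∃ z, B.Adj v z ∧ z ≠ y) {u v : V} {q : G.Walk u v}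
    (hq : q.IsPath) (hlen : q.length = G.diam) : ∃ y ∈ q.support, y ∈ B.verts := by
  by_contra! hcon
  obtain ⟨b, hb⟩ := hB
  have hhigh : ∀ y, h y ≤ G.diam := fun y =>
    le_diam_of_lipschitz hG hH.height_le (x := b) (y := y) (by rw [hH.height_base b hb]; omega)
  have hpos : ∀ y ∉ B.verts, 1 ≤ h y := fun y hy => by rw [hH.height y hy]; omega
  cases q with
  | nil => rw [SimpleGraph.Walk.length_nil] at hlen; omega
  | @cons _ y _ hadj q =>
    rw [SimpleGraph.Walk.cons_isPath_iff] at hq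
    rw [SimpleGraph.Walk.length_cons] at hlen
    simp only [SimpleGraph.Walk.support_cons, List.mem_cons] at hcon
    have hu : u ∉ B.verts := hcon u (Or.inl rfl)
    have hv : v ∉ B.verts := hcon v (Or.inr q.end_mem_support)
    have hq' : ∀ w ∈ q.support, w ∉ B.verts := fun w hw => hcon w (Or.inr hw)
    have h1 := hpos u hu
    have h2 := hpos v hv
    rcases hH.adj_cases u y hadj with h3 | ⟨-, h3⟩ | ⟨h3, h4⟩
    · exact hu (B.edge_vert h3)
    · have h5 := hw.height_eq_add_length hH hmin q u hu h3 hq.2 hq.1 hq'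
      have h6 := hH.height u hu
      have h7 := hhigh u
      rw [← h3] at h6
      omega
    · have h5 := hH.height_add_length q u h4 hq.2 hq.1 hq'
      have h6 := hH.height y h3
      have h7 := hhigh v
      rw [← h4] at h6
      omega

/-- The vertices outside both the base and a diametral path are pendant vertices hanging from one
vertex `w` of the base. A highest such vertex is pendant, so its neighbour has the largest Perron
weight, which puts the neighbour in the base. -/
lemma IsExtremalWeight.exists_outside_parent [Fintype V] (hw : IsExtremalWeight G x)
    (hH : IsHanging G B p h) (hB : B.verts.Nonempty)
    (hmin : ∀ v ∈ B.verts, ∀ y, ∃ z, B.Adj v z ∧ z ≠ y) {r s : V} {q : G.Walk r s}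
    (hrs : G.dist r s = G.diam) (hmeet : ∃ y ∈ q.support, y ∈ B.verts) :
    ∃ w ∈ B.verts, ∀ u ∈ outsideVertices G q B, ∀ y, G.Adj u y ↔ y = w := by
  classical
  set U := outsideVertices G q B with hU
  have hchild : ∀ u ∈ U, ∀ v ∉ B.verts, u = p v → v ∈ U := by
    intro u hu v hv huv
    refine ⟨fun hvq => ?_, hv⟩
    obtain ⟨b, hbq, hb⟩ := hmeet
    have hsub : u ∉ ((q.takeUntil v hvq).reverse.append (q.takeUntil b hbq)).support := by
      intro hmem
      rw [SimpleGraph.Walk.mem_support_append_iff, SimpleGraph.Walk.support_reverse,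
        List.mem_reverse] at hmem
      rcases hmem with h1 | h1
      · exact hu.1 (q.support_takeUntil_subset_support hvq h1)
      · exact hu.1 (q.support_takeUntil_subset_support hbq h1)
    refine hH.not_mem_of_walk _ ⟨1, huv.symm, fun j hj => ?_⟩ hsub hb
    interval_cases j
    · exact hv
    · rw [Function.iterate_one, ← huv]; exact hu.2
  have hleaf : ∀ u ∈ U, (∀ v ∉ B.verts, u ≠ p v) → ∀ y, G.Adj u y → y = p u := by
    intro u hu hno y hy
    rcases hH.adj_cases u y hy with h1 | ⟨-, h1⟩ | ⟨h1, h2⟩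
    · exact absurd (B.edge_vert h1) hu.2
    · exact h1
    · exact absurd h2 (hno y h1)
  have hne : ∀ u ∈ U, r ≠ u ∧ s ≠ u := fun u hu =>
    ⟨fun h => hu.1 (h ▸ q.start_mem_support), fun h => hu.1 (h ▸ q.end_mem_support)⟩
  have hbase : ∀ u ∈ U, (∀ v ∉ B.verts, u ≠ p v) → p u ∈ B.verts := by
    intro u hu hno
    by_contra hpu
    have h1 := hw.lt_of_leaf (hH.adj_parent u hu.2) (hleaf u hu hno) hrs (hne u hu).1 (hne u hu).2
      (hH.ne_parent_parent hu.2 hpu).symm (hH.adj_parent _ hpu).ne.symm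
    have h2 := hw.lt_parent hH hmin hpu
    linarith
  rcases U.eq_empty_or_nonempty with hemp | hnon
  · obtain ⟨b, hb⟩ := hB
    exact ⟨b, hb, fun u hu => by rw [hemp] at hu; exact absurd hu (Set.notMem_empty u)⟩
  obtain ⟨m, hm, hmax⟩ := Set.exists_max_image U h (Set.toFinite _) hnon
  have hmno : ∀ v ∉ B.verts, m ≠ p v := by
    intro v hv hmv
    have h1 := hmax v (hchild m hm v hv hmv)
    have h2 := hH.height v hv
    rw [← hmv] at h2
    omega
  have hpm := hbase m hm hmno
  have hm1 : h m = 1 := by rw [hH.height m hm.2, hH.height_base _ hpm]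
  have hno : ∀ u ∈ U, ∀ v ∉ B.verts, u ≠ p v := by
    intro u hu v hv huv
    have h1 := hmax v (hchild u hu v hv huv)
    have h2 := hH.height v hv
    have h3 := hH.height u hu.2
    rw [← huv] at h2
    omega
  refine ⟨p m, hpm, fun u hu y => ?_⟩
  have hpu : p u = p m := by
    by_contra hpne
    have hpu := hbase u hu (hno u hu)
    have h1 := hw.lt_of_leaf (hH.adj_parent m hm.2) (hleaf m hm hmno) hrs (hne m hm).1
      (hne m hm).2 (w := p u) (fun h => hm.2 (h ▸ hpu)) hpne
    have h2 := hw.lt_of_leaf (hH.adj_parent u hu.2) (hleaf u hu (hno u hu)) hrs (hne u hu).1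
      (hne u hu).2 (w := p m) (fun h => hu.2 (h ▸ hpm)) (Ne.symm hpne)
    linarith
  rw [← hpu]
  exact ⟨hleaf u hu (hno u hu) y, fun h => h ▸ hH.adj_parent u hu.2⟩

lemma inducesStar_of_forall {U : Set V} {w : V} (hwU : w ∉ U)
    (hU : ∀ u ∈ U, ∀ y, G.Adj u y ↔ y = w) : InducesStar G U w := by
  unfold InducesStar
  ext ⟨a, ha⟩ ⟨b, hb⟩
  simp only [SimpleGraph.induce_adj, SimpleGraph.starGraph, SimpleGraph.fromRel_adj, ne_eq,
    Subtype.mk.injEq]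
  constructor
  · intro hab
    refine ⟨hab.ne, ?_⟩
    rcases ha with rfl | ha
    · exact Or.inl rfl
    · exact Or.inr ((hU a ha b).1 hab)
  · rintro ⟨hne, rfl | rfl⟩
    · rcases hb with rfl | hb
      · exact absurd rfl hne
      · exact ((hU b hb a).2 rfl).symm
    · rcases ha with rfl | ha
      · exact absurd rfl hne
      · exact (hU a ha b).2 rfl

end ExtremalBase

/-! ### Unicyclic and bicyclic graphs with all edges in triangles -/

section Classification

variable {W : Type*} {H : SimpleGraph W}

lemma surjective_of_closed (hH : H.Connected) {ι : Type*} [Nonempty ι] (f : ι → W)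
    (hf : ∀ i y, H.Adj (f i) y → ∃ j, f j = y) : Function.Surjective f := by
  intro y
  obtain ⟨i⟩ := ‹Nonempty ι›
  obtain ⟨q⟩ := hH.preconnected (f i) y
  suffices ∀ {a b : W} (_ : H.Walk a b), (∃ j, f j = a) → ∃ j, f j = b from this q ⟨i, rfl⟩
  intro a b q
  induction q with
  | nil => exact id
  | cons hadj _ ih => rintro ⟨j, rfl⟩; exact ih (hf j _ hadj)

lemma nonempty_iso_of_closed (hH : H.Connected) {ι : Type*} [Nonempty ι] {F : SimpleGraph ι}
    (f : ι → W) (hinj : Function.Injective f)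
    (hf : ∀ i y, H.Adj (f i) y ↔ ∃ j, F.Adj i j ∧ y = f j) : Nonempty (H ≃g F) := by
  have hsurj := surjective_of_closed hH f fun i y h => by
    obtain ⟨j, -, rfl⟩ := (hf i y).1 h
    exact ⟨j, rfl⟩
  refine ⟨(⟨Equiv.ofBijective f ⟨hinj, hsurj⟩, fun {i j} => ?_⟩ : F ≃g H).symm⟩
  refine (hf i (f j)).trans ⟨?_, fun h => ⟨j, h, rfl⟩⟩
  rintro ⟨k, hk, hjk⟩
  rwa [hinj hjk]

variable [Fintype W] [DecidableRel H.Adj]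

/-- Known neighbours, as many as the degree, are all the neighbours. -/
lemma mem_of_degree_eq {v : W} {s : Finset W} (hs : ∀ y ∈ s, H.Adj v y) (hdeg : H.degree v ≤ #s)
    {y : W} (hy : H.Adj v y) : y ∈ s := by
  have hsub : s ⊆ H.neighborFinset v := fun z hz => by
    rw [SimpleGraph.mem_neighborFinset]; exact hs z hz
  rw [eq_of_subset_of_card_le hsub (by rwa [SimpleGraph.card_neighborFinset_eq_degree])]
  rwa [SimpleGraph.mem_neighborFinset]

/-- A vertex of degree larger than the number of given vertices has another neighbour. -/
lemma exists_adj_notMem {v : W} {s : Finset W} (hdeg : #s < H.degree v) :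
    ∃ y, H.Adj v y ∧ y ∉ s := by
  obtain ⟨y, hy, hys⟩ := exists_mem_notMem_of_card_lt_card
    (s := s) (t := H.neighborFinset v) (by rwa [SimpleGraph.card_neighborFinset_eq_degree])
  exact ⟨y, by rwa [SimpleGraph.mem_neighborFinset] at hy, hys⟩

lemma adj_pair_of_degree_two [DecidableEq W] {v a b : W} (hdeg : H.degree v = 2) (ha : H.Adj v a)
    (hb : H.Adj v b) (hab : a ≠ b) {y : W} : H.Adj v y ↔ y = a ∨ y = b := by
  constructor
  · intro hy
    simpa using mem_of_degree_eq (s := {a, b}) (by simp [ha, hb])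
      (by rw [hdeg, card_pair hab]) hy
  · rintro (rfl | rfl) <;> assumption

/-- The degree excesses over two sum up to `2 (t - 1)`. -/
lemma sum_degree_sub_two {t : ℕ} (hcard : H.edgeSet.ncard + 1 = Fintype.card W + t)
    (hdeg : ∀ v, 2 ≤ H.degree v) : ∑ v, (H.degree v - 2) + 2 = 2 * t := by
  have h1 := H.sum_degrees_eq_twice_card_edges
  have h2 : H.edgeSet.ncard = #H.edgeFinset := by
    rw [← SimpleGraph.coe_edgeFinset, Set.ncard_coe_finset]
  have h3 : ∑ v, H.degree v = ∑ v, (H.degree v - 2) + Fintype.card W * 2 := by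
    rw [← smul_eq_mul, ← card_univ, ← sum_const, ← sum_add_distrib]
    exact sum_congr rfl fun v _ => (Nat.sub_add_cancel (hdeg v)).symm
  omega

lemma nonempty_iso_cycleGraph_three [DecidableEq W] (hH : H.Connected)
    (hcard : H.edgeSet.ncard + 1 = Fintype.card W + 1) (hdeg : ∀ v, 2 ≤ H.degree v)
    (htri : ∀ a b, H.Adj a b → ∃ c, H.Adj a c ∧ H.Adj b c) :
    Nonempty (H ≃g SimpleGraph.cycleGraph 3) := by
  have hsum := sum_degree_sub_two hcard hdeg
  have hdeg2 : ∀ v, H.degree v = 2 := by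
    intro v
    have h1 := single_le_sum (f := fun v => H.degree v - 2) (fun _ _ => Nat.zero_le _) (mem_univ v)
    have h2 := hdeg v
    omega
  obtain ⟨a⟩ := hH.nonempty
  obtain ⟨b, hab, -⟩ := exists_adj_notMem (H := H) (v := a) (s := ∅) (by simp [hdeg2])
  obtain ⟨c, hac, hbc⟩ := htri a b hab
  have hNa := fun y => adj_pair_of_degree_two (hdeg2 a) hab hac hbc.ne (y := y)
  have hNb := fun y => adj_pair_of_degree_two (hdeg2 b) hab.symm hbc hac.ne (y := y)
  have hNc := fun y => adj_pair_of_degree_two (hdeg2 c) hac.symm hbc.symm hab.ne (y := y)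
  refine nonempty_iso_of_closed hH ![a, b, c] ?_ ?_
  · intro i j
    fin_cases i <;> fin_cases j <;>
      simp [hab.ne, hac.ne, hbc.ne, hab.ne.symm, hac.ne.symm, hbc.ne.symm]
  · intro i y
    rw [SimpleGraph.cycleGraph_three_eq_top]
    fin_cases i <;> simp [Fin.exists_fin_succ, hNa, hNb, hNc]

/-- A vertex of degree four whose neighbours have degree two: the neighbours pair up. -/
lemma nonempty_iso_bowtie [DecidableEq W] (hH : H.Connected)
    (htri : ∀ a b, H.Adj a b → ∃ c, H.Adj a c ∧ H.Adj b c) {z : W} (hz : H.degree z = 4)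
    (hdeg : ∀ v, v ≠ z → H.degree v = 2) : Nonempty (H ≃g bowtie) := by
  obtain ⟨a, hza, -⟩ := exists_adj_notMem (H := H) (v := z) (s := ∅) (by simp [hz])
  obtain ⟨b, hzb, hab⟩ := htri z a hza
  have hNa := fun y => adj_pair_of_degree_two (hdeg a hza.ne.symm) hza.symm hab hzb.ne (y := y)
  have hNb := fun y => adj_pair_of_degree_two (hdeg b hzb.ne.symm) hzb.symm hab.symm hza.ne (y := y)
  obtain ⟨c, hzc, hc⟩ := exists_adj_notMem (H := H) (v := z) (s := {a, b})
    (by rw [hz, card_pair hab.ne]; norm_num)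
  simp only [mem_insert, mem_singleton, not_or] at hc
  obtain ⟨e, hze, hce⟩ := htri z c hzc
  have hea : e ≠ a := by
    rintro rfl
    rcases (hNa c).1 hce.symm with h | h
    · exact hzc.ne h.symm
    · exact hc.2 h
  have heb : e ≠ b := by
    rintro rfl
    rcases (hNb c).1 hce.symm with h | h
    · exact hzc.ne h.symm
    · exact hc.1 h
  have hNc := fun y => adj_pair_of_degree_two (hdeg c hzc.ne.symm) hzc.symm hce hze.ne (y := y)
  have hNe := fun y => adj_pair_of_degree_two (hdeg e hze.ne.symm) hze.symm hce.symm hzc.ne (y := y)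
  have hNz : ∀ y, H.Adj z y ↔ y = a ∨ y = b ∨ y = c ∨ y = e := by
    intro y
    constructor
    · intro hy
      have h4 : #({a, b, c, e} : Finset W) = 4 := by
        rw [card_insert_of_notMem (by simp [hab.ne, Ne.symm hc.1, hea.symm]),
          card_eq_three.2 ⟨b, c, e, Ne.symm hc.2, heb.symm, hce.ne, rfl⟩]
      simpa using mem_of_degree_eq (s := {a, b, c, e}) (by simp [hza, hzb, hzc, hze])
        (by rw [hz, h4]) hy
    · rintro (rfl | rfl | rfl | rfl) <;> assumption
  refine nonempty_iso_of_closed hH ![z, a, b, c, e] ?_ ?_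
  · intro i j
    fin_cases i <;> fin_cases j <;>
      simp [hza.ne, hzb.ne, hzc.ne, hze.ne, hza.ne.symm, hzb.ne.symm, hzc.ne.symm, hze.ne.symm,
        hab.ne, hab.ne.symm, hce.ne, hce.ne.symm, hea, heb, hea.symm, heb.symm, hc.1, hc.2,
        Ne.symm hc.1, Ne.symm hc.2]
  · intro i y
    fin_cases i <;> simp [bowtie, Fin.exists_fin_succ, hNz, hNa, hNb, hNc, hNe]

/-- Two vertices of degree three, the others of degree two: the two are adjacent, and their other
neighbours are common neighbours. -/
lemma nonempty_iso_thetaGraph [DecidableEq W] (hH : H.Connected)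
    (htri : ∀ a b, H.Adj a b → ∃ c, H.Adj a c ∧ H.Adj b c) {y z : W} (hyz : y ≠ z)
    (hy : H.degree y = 3) (hz : H.degree z = 3) (hdeg : ∀ v, v ≠ y → v ≠ z → H.degree v = 2) :
    Nonempty (H ≃g thetaGraph) := by
  have hadj : H.Adj y z := by
    -- otherwise all neighbours of `y` have degree two, and they would pair up
    by_contra hnot
    have hnz : ∀ v, H.Adj y v → v ≠ z := fun v hv h => hnot (h ▸ hv)
    obtain ⟨a, hya, -⟩ := exists_adj_notMem (H := H) (v := y) (s := ∅) (by simp [hy])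
    obtain ⟨b, hyb, hab⟩ := htri y a hya
    have hNa := fun w => adj_pair_of_degree_two (hdeg a hya.ne.symm (hnz a hya)) hya.symm hab
      hyb.ne (y := w)
    have hNb := fun w => adj_pair_of_degree_two (hdeg b hyb.ne.symm (hnz b hyb)) hyb.symm hab.symm
      hya.ne (y := w)
    obtain ⟨c, hyc, hc⟩ := exists_adj_notMem (H := H) (v := y) (s := {a, b})
      (by rw [hy, card_pair hab.ne]; norm_num)
    simp only [mem_insert, mem_singleton, not_or] at hc
    obtain ⟨e, hye, hce⟩ := htri y c hyc
    have h1 := mem_of_degree_eq (v := y) (s := {a, b, c}) (by simp [hya, hyb, hyc])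
      (by rw [hy, card_eq_three.2 ⟨a, b, c, hab.ne, Ne.symm hc.1, Ne.symm hc.2, rfl⟩]) hye
    simp only [mem_insert, mem_singleton] at h1
    rcases h1 with rfl | rfl | rfl
    · rcases (hNa c).1 hce.symm with h | h
      · exact hyc.ne h.symm
      · exact hc.2 h
    · rcases (hNb c).1 hce.symm with h | h
      · exact hyc.ne h.symm
      · exact hc.1 h
    · exact hce.ne rfl
  obtain ⟨c, hyc, hzc⟩ := htri y z hadj
  have hNc := fun w => adj_pair_of_degree_two (hdeg c hyc.ne.symm hzc.ne.symm) hyc.symm hzc.symm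
    hyz (y := w)
  obtain ⟨e, hye, he⟩ := exists_adj_notMem (H := H) (v := y) (s := {z, c})
    (by rw [hy, card_pair hzc.ne]; norm_num)
  simp only [mem_insert, mem_singleton, not_or] at he
  have hNy : ∀ w, H.Adj y w ↔ w = z ∨ w = c ∨ w = e := by
    intro w
    constructor
    · intro hw
      simpa using mem_of_degree_eq (v := y) (s := {z, c, e}) (by simp [hadj, hyc, hye])
        (by rw [hy, card_eq_three.2 ⟨z, c, e, hzc.ne, Ne.symm he.1, Ne.symm he.2, rfl⟩]) hw
    · rintro (rfl | rfl | rfl) <;> assumption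
  obtain ⟨f, hyf, hef⟩ := htri y e hye
  obtain rfl : f = z := by
    rcases (hNy f).1 hyf with h | rfl | rfl
    · exact h
    · rcases (hNc e).1 hef.symm with h | h
      · exact absurd h hye.ne.symm
      · exact absurd h he.1
    · exact absurd rfl hef.ne
  have hNe := fun w => adj_pair_of_degree_two (hdeg e hye.ne.symm he.1) hye.symm hef hyz (y := w)
  have hNz : ∀ w, H.Adj f w ↔ w = y ∨ w = c ∨ w = e := by
    intro w
    constructor
    · intro hw
      simpa using mem_of_degree_eq (v := f) (s := {y, c, e}) (by simp [hadj.symm, hzc, hef.symm])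
        (by rw [hz, card_eq_three.2 ⟨y, c, e, hyc.ne, hye.ne, Ne.symm he.2, rfl⟩]) hw
    · rintro (rfl | rfl | rfl)
      · exact hadj.symm
      · exact hzc
      · exact hef.symm
  refine nonempty_iso_of_closed hH ![c, y, e, f] ?_ ?_
  · intro i j
    fin_cases i <;> fin_cases j <;>
      simp [hyc.ne, hye.ne, hzc.ne, hef.ne, hadj.ne, hyc.ne.symm, hye.ne.symm, hzc.ne.symm,
        hef.ne.symm, hadj.ne.symm, he.2, Ne.symm he.2]
  · intro i w
    fin_cases i <;> simp [thetaGraph, Fin.exists_fin_succ, hNy, hNz, hNc, hNe] <;> tauto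

lemma nonempty_iso_bowtie_or_thetaGraph [DecidableEq W] (hH : H.Connected)
    (hcard : H.edgeSet.ncard + 1 = Fintype.card W + 2) (hdeg : ∀ v, 2 ≤ H.degree v)
    (htri : ∀ a b, H.Adj a b → ∃ c, H.Adj a c ∧ H.Adj b c) :
    Nonempty (H ≃g bowtie) ∨ Nonempty (H ≃g thetaGraph) := by
  have hsum := sum_degree_sub_two hcard hdeg
  have hsum2 : ∑ v, (H.degree v - 2) = 2 := by omega
  obtain ⟨z, -, hz⟩ := exists_ne_zero_of_sum_ne_zero (by rw [hsum2]; norm_num)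
  rw [← add_sum_erase _ _ (mem_univ z)] at hsum2
  have hle : ∀ v, v ≠ z → H.degree v - 2 ≤ ∑ w ∈ univ.erase z, (H.degree w - 2) := fun v hv =>
    single_le_sum (f := fun v => H.degree v - 2) (fun _ _ => Nat.zero_le _)
      (mem_erase.2 ⟨hv, mem_univ v⟩)
  by_cases h2 : H.degree z - 2 = 2
  · left
    refine nonempty_iso_bowtie hH htri (z := z) (by omega) fun v hv => ?_
    have h3 := hle v hv
    have h4 := hdeg v
    omega
  · right
    have hrest : ∑ w ∈ univ.erase z, (H.degree w - 2) = 1 := by omega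
    obtain ⟨y, hy, hy0⟩ := exists_ne_zero_of_sum_ne_zero (by rw [hrest]; norm_num)
    have hyz : y ≠ z := (mem_erase.1 hy).1
    have hy1 := hle y hyz
    rw [← add_sum_erase _ _ hy] at hrest
    refine nonempty_iso_thetaGraph hH htri hyz (by omega) (by omega) fun v hvy hvz => ?_
    have h3 := single_le_sum (f := fun v => H.degree v - 2) (s := (univ.erase z).erase y)
      (fun _ _ => Nat.zero_le _) (mem_erase.2 ⟨hvy, mem_erase.2 ⟨hvz, mem_univ v⟩⟩)
    have h4 := hdeg v
    omega

end Classification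

/-! ### The isomorphism type of the base; complete graphs -/

section Conclusion

lemma IsBase.nonempty_iso {V : Type*} [Finite V] {G : SimpleGraph V} {B : G.Subgraph} {t : ℕ}
    (hB : IsBase t G B) (hmin : ∀ v ∈ B.verts, ∀ y, ∃ z, B.Adj v z ∧ z ≠ y)
    (htri : ∀ a b, B.Adj a b → ∃ c, B.Adj a c ∧ B.Adj b c) :
    (t = 1 → Nonempty (B.coe ≃g SimpleGraph.cycleGraph 3)) ∧
      (t = 2 → Nonempty (B.coe ≃g bowtie) ∨ Nonempty (B.coe ≃g thetaGraph)) := by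
  classical
  have : Fintype B.verts := Fintype.ofFinite _
  obtain ⟨hc, hcard⟩ := hB.1
  rw [Nat.card_eq_fintype_card] at hcard
  have hdeg : ∀ v, 2 ≤ B.coe.degree v := by
    intro v
    obtain ⟨y, hy, -⟩ := hmin v v.2 v
    obtain ⟨z, hz, hzy⟩ := hmin v v.2 y
    rw [← SimpleGraph.card_neighborFinset_eq_degree]
    refine one_lt_card.2 ⟨⟨y, B.edge_vert hy.symm⟩, ?_, ⟨z, B.edge_vert hz.symm⟩, ?_, ?_⟩
    · rw [SimpleGraph.mem_neighborFinset]; exact hy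
    · rw [SimpleGraph.mem_neighborFinset]; exact hz
    · exact fun h => hzy (congrArg Subtype.val h).symm
  have htri' : ∀ a b, B.coe.Adj a b → ∃ c, B.coe.Adj a c ∧ B.coe.Adj b c := by
    intro a b hab
    obtain ⟨c, hac, hbc⟩ := htri a b hab
    exact ⟨⟨c, B.edge_vert hac.symm⟩, hac, hbc⟩
  constructor
  · rintro rfl
    exact nonempty_iso_cycleGraph_three hc hcard (fun v => by convert hdeg v) htri'
  · rintro rfl
    exact nonempty_iso_bowtie_or_thetaGraph hc hcard (fun v => by convert hdeg v) htri'

variable {V : Type*} {G : SimpleGraph V}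

lemma adj_of_diam_le_one [Finite V] (hG : G.Connected) (hd : G.diam ≤ 1) {a b : V} (hab : a ≠ b) :
    G.Adj a b := by
  have h1 := dist_le_diam_of_connected hG a b
  have h2 := hG.pos_dist_of_ne hab
  exact SimpleGraph.dist_eq_one_iff_adj.1 (by omega)

lemma inTriangle_of_forall_adj [Fintype V] (hG : ∀ a b, a ≠ b → G.Adj a b) {e : Sym2 V}
    (he : IsInternalPathEdge G e) : InTriangle G e := by
  obtain ⟨u, hu, he⟩ : ∃ u, 3 ≤ (G.neighborSet u).ncard ∧ e ∈ G.edgeSet := by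
    rcases he with ⟨u, v, p, -, hd, he⟩ | ⟨u, p, -, hd, he⟩
    · exact ⟨u, hd.1, p.edges_subset_edgeSet he⟩
    · exact ⟨u, hd.1, p.edges_subset_edgeSet he⟩
  induction e using Sym2.ind with | _ a b
  have h2 := Set.ncard_insert_le a {b}
  rw [Set.ncard_singleton] at h2
  obtain ⟨c, -, hc⟩ := Set.exists_mem_notMem_of_ncard_lt_ncard
    (show ({a, b} : Set V).ncard < (G.neighborSet u).ncard by omega)
  simp only [Set.mem_insert_iff, Set.mem_singleton_iff, not_or] at hc
  exact ⟨a, b, c, he, hG _ _ (Ne.symm hc.2), hG _ _ hc.1, rfl⟩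

/-- Nothing hangs from a base of minimum degree two in a complete graph. -/
lemma IsHanging.mem_verts_of_forall_adj {B : G.Subgraph} {p : V → V} {h : V → ℕ}
    (hH : IsHanging G B p h) (hB : B.verts.Nonempty)
    (hmin : ∀ v ∈ B.verts, ∀ y, ∃ z, B.Adj v z ∧ z ≠ y)
    (hG : ∀ a b, a ≠ b → G.Adj a b) (v : V) : v ∈ B.verts := by
  by_contra hv
  obtain ⟨b, hb⟩ := hB
  obtain ⟨z, hz, -⟩ := hmin b hb b
  have hne : ∀ w ∈ B.verts, v ≠ w := fun w hw h => hv (h ▸ hw)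
  exact hH.not_adj_of_adj hv (hG _ _ (hne b hb)) z (hG _ _ (hne z (B.edge_vert hz.symm)))
    (B.adj_sub hz)

end Conclusion

end AlphaExtremal

open AlphaExtremal

theorem mainTheorem4 (α : ℝ) (hα0 : 0 ≤ α) (hα1 : α < 1) (t n d : ℕ)
    (G : SimpleGraph (Fin n)) (hG : AlphaExtremal.IsExtremal α t n d G) :
    (∀ e : Sym2 (Fin n), AlphaExtremal.IsInternalPathEdge G e → AlphaExtremal.InTriangle G e) ∧
    (1 ≤ t → ∀ B : G.Subgraph, AlphaExtremal.IsBase t G B →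
      (∀ (u v : Fin n) (p : G.Walk u v), p.IsPath → p.length = d →
        ∃ x ∈ p.support, x ∈ B.verts) ∧
      (∀ (u v : Fin n) (p : G.Walk u v), AlphaExtremal.IsDiametralPath G p →
        (∃ x ∈ p.support, x ∉ B.verts) →
        ∃ w ∈ B.verts,
          AlphaExtremal.InducesStar G (AlphaExtremal.outsideVertices G p B) w) ∧
      (t = 1 → Nonempty (B.coe ≃g SimpleGraph.cycleGraph 3)) ∧
      (t = 2 → Nonempty (B.coe ≃g AlphaExtremal.bowtie) ∨
        Nonempty (B.coe ≃g AlphaExtremal.thetaGraph))) := by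
  have hconn := hG.1.1.1
  have hdiam := hG.1.2
  rcases le_or_gt d 1 with hd | hd
  · have hcomp : ∀ a b, a ≠ b → G.Adj a b := fun a b hab =>
      adj_of_diam_le_one hconn (by omega) hab
    refine ⟨fun e he => inTriangle_of_forall_adj hcomp he, fun ht B hB => ?_⟩
    obtain ⟨q, h, hH⟩ := exists_isHanging hG.1.1 hB.1
    have hne : B.verts.Nonempty := Set.nonempty_coe_sort.1 hB.1.1.nonempty
    have hmin : ∀ v ∈ B.verts, ∀ y, ∃ z, B.Adj v z ∧ z ≠ y := fun v hv y => hB.exists_adj_ne ht hv y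
    have hall := hH.mem_verts_of_forall_adj hne hmin hcomp
    refine ⟨fun u v p _ _ => ⟨u, p.start_mem_support, hall u⟩,
      fun u v p _ ⟨x, _, hx⟩ => absurd (hall x) hx, hB.nonempty_iso hmin fun a b hab => ?_⟩
    obtain ⟨c, hac, hcb⟩ := hmin a (B.edge_vert hab) b
    exact ⟨c, hac, hH.adj_of_mem (hall b) (hall c) (hcomp b c (Ne.symm hcb))⟩
  · obtain ⟨x, hw⟩ := hG.exists_isExtremalWeight hα0 hα1 hd
    refine ⟨fun e he => hw.inTriangle he, fun ht B hB => ?_⟩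
    obtain ⟨q, h, hH⟩ := exists_isHanging hG.1.1 hB.1
    have hne : B.verts.Nonempty := Set.nonempty_coe_sort.1 hB.1.1.nonempty
    have hmin : ∀ v ∈ B.verts, ∀ y, ∃ z, B.Adj v z ∧ z ≠ y := fun v hv y => hB.exists_adj_ne ht hv y
    have hmeet : ∀ (u v : Fin n) (p : G.Walk u v), p.IsPath → p.length = d →
        ∃ x ∈ p.support, x ∈ B.verts := fun u v p hp hlen =>
      hw.exists_mem_support hconn (by omega) hH hne hmin hp (hlen.trans hdiam.symm)
    refine ⟨hmeet, fun u v p hp _ => ?_, hB.nonempty_iso hmin fun a b hab =>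
      hw.exists_base_triangle hH hmin hab⟩
    obtain ⟨w, hwB, hout⟩ := hw.exists_outside_parent hH hne hmin hp.2.2
      (hmeet u v p hp.1 (hp.2.1.trans hdiam))
    exact ⟨w, hwB, inducesStar_of_forall (fun h => h.2 hwB) hout⟩
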